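/- Let $\mathbb{F}$ be a field of characteristic zero, let $n\ge 0$ and $d$ be integers with $n=3d-4$ (so $d\ge 2$), let $P_n=\mathbb{F}[x_1,\dots,x_n]$, and let $a_{n,d}$ be the number of lattice paths from $(0,0)$ to $(n+2-2d,\,n+2)$ with moves of the type $(i,j)\to(i+1,j+1)$ (right move) or $(i,j)\to(i-1,j+1)$ (left move) such that the first and the last move are to the right and the path does not cross the lines $x=0$ and $x=n+2-2d$ (that is, all of its points satisfy $0\le x\le n+2-2d$). Then for general linear forms $\ell_1,\ell_2\in P_n$, that is, for all pairs $(\ell_1,\ell_2)$ whose coefficient vectors lie in some nonempty Zariski-open subset of $\mathbb{F}^n\times\mathbb{F}^n$, $$ \dim_{\mathbb{F}}\left(\left(\frac{P_n}{(x_1^2,\dots,x_n^2,\ell_1^2,\ell_2^2)}\right)_d\right)=a_{n,d}, $$ where $(\cdot)_d$ denotes the graded piece of degree $d$. In other words, the conjecture of Crispin Quiñonez, Lundqvist and Nenashev holds for $n=3d-4$. -/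

import Mathlib

open MvPolynomial

noncomputable section

/-- The linear form `a_1 x_1 + ⋯ + a_n x_n`. -/
def linForm {F : Type*} [Field F] {n : ℕ} (a : Fin n → F) : MvPolynomial (Fin n) F :=
  ∑ i, C (a i) * X i

/-- The ideal `(x_1^2, …, x_n^2, ℓ_1^2, ℓ_2^2)`. -/
def squaresIdeal {F : Type*} [Field F] {n : ℕ} (l₁ l₂ : MvPolynomial (Fin n) F) :
    Ideal (MvPolynomial (Fin n) F) :=
  Ideal.span (Set.range (fun i : Fin n => (X i : MvPolynomial (Fin n) F) ^ 2) ∪ {l₁ ^ 2, l₂ ^ 2})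

/-- The degree `d` piece of `P_n / J`: the `F`-subspace of residue classes of forms of
degree `d`. For a homogeneous ideal `J` this is the graded piece `(P_n / J)_d`. -/
def quotientPiece {F : Type*} [Field F] {n : ℕ} (J : Ideal (MvPolynomial (Fin n) F)) (d : ℕ) :
    Submodule F (MvPolynomial (Fin n) F ⧸ J) :=
  (homogeneousSubmodule (Fin n) F d).map (Ideal.Quotient.mkₐ F J).toLinearMap

/-- The property `Q` holds for two general linear forms: it holds for all pairs of linear forms
whose coefficient vectors `(a, b)` lie in a nonempty Zariski-open subset of `F^n × F^n`
(over an infinite field the sets `{G ≠ 0}` with `G` a nonzero polynomial are nonempty, and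
they form a base of the nonempty open sets). -/
def ForGeneralPair {F : Type*} [Field F] {n : ℕ}
    (Q : MvPolynomial (Fin n) F → MvPolynomial (Fin n) F → Prop) : Prop :=
  ∃ G : MvPolynomial (Fin n ⊕ Fin n) F, G ≠ 0 ∧
    ∀ a b : Fin n → F, eval (Sum.elim a b) G ≠ 0 → Q (linForm a) (linForm b)

end

/-- A lattice path from `(0, 0)` with `m` moves `(i, j) ↦ (i ± 1, j + 1)` is given by its moves,
`true` being a move to the right. After `j` moves it is at the point `(pathX s j, j)`. -/
def pathX {m : ℕ} (s : Fin m → Bool) (j : ℕ) : ℤ :=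
  ∑ i : Fin m, if (i : ℕ) < j then (if s i then 1 else -1) else 0

/-- The number `a_{n,d}` of lattice paths from `(0, 0)` to `(n + 2 - 2d, n + 2)` whose first and
last moves are to the right and which do not cross the lines `x = 0` and `x = n + 2 - 2d`
(touching the lines is allowed). -/
def pathCount (n d : ℕ) : ℕ :=
  (Finset.univ.filter fun s : Fin (n + 2) → Bool =>
    s 0 = true ∧ s (Fin.last (n + 1)) = true ∧
    pathX s (n + 2) = (n : ℤ) + 2 - 2 * d ∧
    ∀ j ≤ n + 2, 0 ≤ pathX s j ∧ pathX s j ≤ (n : ℤ) + 2 - 2 * d).card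

/-!
# Squares of `n + 2` general linear forms for `n = 3d - 4`

By Macaulay duality (`Cube.rank_quotientPiece`) the dimension in question is that of the space `V`
of forms `f` of degree `d` in the squarefree algebra `F[x_1, …, x_n] / (x_i ^ 2)` with
`D ^ 2 f = D' ^ 2 f = 0`, where `D = ∑ a_i ∂/∂x_i` and `D' = ∑ b_i ∂/∂x_i` have the coefficients of
the two linear forms. The squarefree algebra is encoded as the space of functions on the Boolean
cube, and most arguments are inductions that split off the last variable, `f = f₀ + x_n f₁`.

**Upper bound** (`Cube.generic_finrank_le_stripPaths`). More generally consider the conditions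
`D ^ 2 f = D' ^ k f = 0`. If `a_n = 0` and `b_n ≠ 0`, then `f ↦ f₀` maps this space to the one for
`(n - 1, d, k + 1)`, and its kernel is the space for `(n - 1, d - 1, k - 1)`. The dimensions thus
satisfy the recursion of walks in the strip, removing the last step. The walls of the strip
correspond to `k = 0` and to the Lefschetz property of `D`. Dimensions of kernels are upper
semicontinuous (`Generic.finrank_ker_le`), so the bound passes from these special coefficients to
generic ones.

**Lower bound** (`Cube.binom_le_finrank_inf_killed`). By the reflection principle
(`stripPaths_eq`, `Cube.pathCount_add`) the number of paths for `n = 3d - 4` is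
`C(n,d) - 2 C(n,d-2) + C(n,d-4) + 1`, one more than the naive count, so one hidden relation has to
be found. Together with `E = ∑ a_i⁻¹ x_i` the derivation `D` generates an action of `sl₂`, by which
`D ^ 2 f = 0` implies `E ^ (d-2) f = 0` for forms of degree `d`; likewise for `D'` and
`E' = ∑ b_i⁻¹ x_i`. The product `E ^ (d-2) E' ^ (d-2)` maps degree `d` to the top degree `n`, so it
gives a functional vanishing on `ker D ^ 2 + ker D' ^ 2`, where the kernels are taken in degree `d`.
It does not vanish on all of `ker D ^ 2 D' ^ 2` (`Cube.exists_top_raise_pow_ne_zero`), so the sum of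
the two kernels is a proper subspace of the latter. Since the dimensions of these three kernels are
known from the Lefschetz property, the intersection `V` of the first two has dimension at least the
naive count plus one.
-/

/-! ### Functions on the Boolean cube -/

/-- The space of functions on `{0,1}^n`. A vertex `s` stands for the squarefree monomial
`∏_{s i} x_i`, so this is both the squarefree algebra `F[x_1, …, x_n] / (x_i ^ 2)` and, through
the monomial basis, its dual. -/
abbrev Cube (F : Type*) (n : ℕ) : Type _ := (Fin n → Bool) → F

namespace Cube

variable {F : Type*} [Field F] {n : ℕ}

/-- The part of `f = f₀ + x_n f₁` free of the last variable, that is `f₀`. -/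
def lo (n : ℕ) : Cube F (n + 1) →ₗ[F] Cube F n :=
  LinearMap.funLeft F F fun s => Fin.snoc (α := fun _ => Bool) s false

/-- The cofactor `f₁` of the last variable in `f = f₀ + x_n f₁`. -/
def hi (n : ℕ) : Cube F (n + 1) →ₗ[F] Cube F n :=
  LinearMap.funLeft F F fun s => Fin.snoc (α := fun _ => Bool) s true

/-- The function `f₀ + x_n f₁`. -/
def glue (n : ℕ) : (Cube F n × Cube F n) →ₗ[F] Cube F (n + 1) where
  toFun p s := if s (Fin.last n) then p.2 (Fin.init s) else p.1 (Fin.init s)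
  map_add' p q := by ext s; by_cases h : s (Fin.last n) <;> simp [h]
  map_smul' c p := by ext s; by_cases h : s (Fin.last n) <;> simp [h]

lemma lo_apply (f : Cube F (n + 1)) (s : Fin n → Bool) :
    lo n f s = f (Fin.snoc (α := fun _ => Bool) s false) := rfl

lemma hi_apply (f : Cube F (n + 1)) (s : Fin n → Bool) :
    hi n f s = f (Fin.snoc (α := fun _ => Bool) s true) := rfl

@[simp] lemma lo_glue (p : Cube F n × Cube F n) : lo n (glue n p) = p.1 := by
  ext s; simp [lo_apply, glue]

@[simp] lemma hi_glue (p : Cube F n × Cube F n) : hi n (glue n p) = p.2 := by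
  ext s; simp [hi_apply, glue]

lemma ext_lo_hi {f g : Cube F (n + 1)} (h0 : lo n f = lo n g) (h1 : hi n f = hi n g) : f = g := by
  ext s
  rw [← Fin.snoc_init_self (α := fun _ => Bool) s]
  cases h : s (Fin.last n)
  · exact congrFun h0 (Fin.init s)
  · exact congrFun h1 (Fin.init s)

/-- The number of variables in the monomial of the vertex `s`. -/
def weight (s : Fin n → Bool) : ℤ := ∑ i, if s i then 1 else 0

lemma weight_snoc (s : Fin n → Bool) (b : Bool) :
    weight (Fin.snoc (α := fun _ => Bool) s b : Fin (n + 1) → Bool) =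
      weight s + if b then 1 else 0 := by
  simp only [weight, Fin.sum_univ_castSucc, Fin.snoc_castSucc, Fin.snoc_last]

/-- The forms of degree `d`: functions supported on the vertices of weight `d`. The degree is an
integer, so that `forms F n (d - 1)` needs no case distinction. -/
def forms (F : Type*) [Field F] (n : ℕ) (d : ℤ) : Submodule F (Cube F n) where
  carrier := {f | ∀ s, weight s ≠ d → f s = 0}
  add_mem' hf hg s hs := by simp [hf s hs, hg s hs]
  zero_mem' s _ := rfl
  smul_mem' c f hf s hs := by simp [hf s hs]

lemma mem_forms_succ {d : ℤ} {f : Cube F (n + 1)} :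
    f ∈ forms F (n + 1) d ↔ lo n f ∈ forms F n d ∧ hi n f ∈ forms F n (d - 1) := by
  constructor
  · intro h
    refine ⟨fun s hs => h _ ?_, fun s hs => h _ ?_⟩
    · simpa [weight_snoc] using hs
    · rw [weight_snoc]
      simp only [if_true]
      omega
  · rintro ⟨h0, h1⟩ s hs
    rw [← Fin.snoc_init_self (α := fun _ => Bool) s] at hs ⊢
    rw [weight_snoc] at hs
    cases h : s (Fin.last n)
    · exact h0 _ (by simpa [h] using hs)
    · refine h1 _ ?_
      rw [h] at hs
      simp only [if_true] at hs
      omega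

lemma forms_zero_eq_zero {d : ℤ} (hd : d ≠ 0) {f : Cube F 0} (hf : f ∈ forms F 0 d) : f = 0 := by
  ext s
  exact hf s (by simpa [weight] using hd.symm)

lemma mem_forms_zero_zero (f : Cube F 0) : f ∈ forms F 0 0 := by
  intro s hs
  simp [weight] at hs

/-- The derivation `∑ a_i ∂/∂x_i`. -/
def lower (a : ℕ → F) : ∀ n, Cube F n →ₗ[F] Cube F n
  | 0 => 0
  | n + 1 => glue n ∘ₗ (lower a n ∘ₗ lo n + a n • hi n).prod (lower a n ∘ₗ hi n)

/-- Multiplication by the linear form `∑ e_i x_i` in the squarefree algebra. -/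
def raise (e : ℕ → F) : ∀ n, Cube F n →ₗ[F] Cube F n
  | 0 => 0
  | n + 1 => glue n ∘ₗ (raise e n ∘ₗ lo n).prod (raise e n ∘ₗ hi n + e n • lo n)

section
variable (a b e e' : ℕ → F)

lemma apply_pow {V : Type*} [AddCommGroup V] [Module F V] (T : Module.End F V) (k : ℕ) (x : V) :
    T ((T ^ k) x) = (T ^ (k + 1)) x := by
  rw [pow_succ', Module.End.mul_apply]

@[simp] lemma lower_zero : lower a 0 = 0 := rfl
@[simp] lemma raise_zero : raise a 0 = 0 := rfl

@[simp] lemma lo_lower (f : Cube F (n + 1)) :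
    lo n (lower a (n + 1) f) = lower a n (lo n f) + a n • hi n f := by simp [lower]

@[simp] lemma hi_lower (f : Cube F (n + 1)) :
    hi n (lower a (n + 1) f) = lower a n (hi n f) := by simp [lower]

@[simp] lemma lo_raise (f : Cube F (n + 1)) :
    lo n (raise e (n + 1) f) = raise e n (lo n f) := by simp [raise]

@[simp] lemma hi_raise (f : Cube F (n + 1)) :
    hi n (raise e (n + 1) f) = raise e n (hi n f) + e n • lo n f := by simp [raise]

@[simp] lemma hi_lower_pow (k : ℕ) (f : Cube F (n + 1)) :
    hi n ((lower a (n + 1) ^ k) f) = (lower a n ^ k) (hi n f) := by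
  induction k generalizing f with
  | zero => simp
  | succ k ih => simp [pow_succ, ih]

lemma lo_lower_pow (k : ℕ) (f : Cube F (n + 1)) :
    lo n ((lower a (n + 1) ^ (k + 1)) f) =
      (lower a n ^ (k + 1)) (lo n f) + ((k + 1 : F) * a n) • (lower a n ^ k) (hi n f) := by
  induction k with
  | zero => simp
  | succ k ih =>
    rw [← apply_pow, lo_lower, ih, hi_lower_pow, map_add, map_smul, apply_pow, apply_pow]
    push_cast
    module

@[simp] lemma lo_raise_pow (k : ℕ) (f : Cube F (n + 1)) :
    lo n ((raise e (n + 1) ^ k) f) = (raise e n ^ k) (lo n f) := by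
  induction k generalizing f with
  | zero => simp
  | succ k ih => simp [pow_succ, ih]

lemma hi_raise_pow (k : ℕ) (f : Cube F (n + 1)) :
    hi n ((raise e (n + 1) ^ (k + 1)) f) =
      (raise e n ^ (k + 1)) (hi n f) + ((k + 1 : F) * e n) • (raise e n ^ k) (lo n f) := by
  induction k with
  | zero => simp
  | succ k ih =>
    rw [← apply_pow, hi_raise, ih, lo_raise_pow, map_add, map_smul, apply_pow, apply_pow]
    push_cast
    module

lemma lower_comm : Commute (lower a n) (lower b n) := by
  induction n with
  | zero => exact Commute.refl _
  | succ n ih =>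
    have ih' : ∀ f, lower a n (lower b n f) = lower b n (lower a n f) := LinearMap.congr_fun ih
    refine LinearMap.ext fun f => ext_lo_hi ?_ ?_
    · simp only [Module.End.mul_apply, lo_lower, hi_lower, map_add, map_smul, ih']
      abel
    · simp [ih']

lemma raise_comm : Commute (raise e n) (raise e' n) := by
  induction n with
  | zero => exact Commute.refl _
  | succ n ih =>
    have ih' : ∀ f, raise e n (raise e' n f) = raise e' n (raise e n f) := LinearMap.congr_fun ih
    refine LinearMap.ext fun f => ext_lo_hi ?_ ?_
    · simp [ih']
    · simp only [Module.End.mul_apply, lo_raise, hi_raise, map_add, map_smul, ih']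
      abel

variable {a b e e'}

lemma lower_mem {d : ℤ} {f : Cube F n} (hf : f ∈ forms F n d) :
    lower a n f ∈ forms F n (d - 1) := by
  induction n generalizing d with
  | zero => simp
  | succ n ih =>
    rw [mem_forms_succ] at hf ⊢
    rw [lo_lower, hi_lower]
    exact ⟨add_mem (ih hf.1) (Submodule.smul_mem _ _ hf.2), ih hf.2⟩

lemma lower_pow_mem {d : ℤ} {f : Cube F n} (hf : f ∈ forms F n d) (k : ℕ) :
    (lower a n ^ k) f ∈ forms F n (d - k) := by
  induction k with
  | zero => simpa using hf
  | succ k ih =>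
    rw [pow_succ', Module.End.mul_apply, show d - ((k + 1 : ℕ) : ℤ) = d - k - 1 by push_cast; ring]
    exact lower_mem ih

lemma raise_mem {d : ℤ} {f : Cube F n} (hf : f ∈ forms F n d) :
    raise e n f ∈ forms F n (d + 1) := by
  induction n generalizing d with
  | zero => simp
  | succ n ih =>
    rw [mem_forms_succ] at hf ⊢
    rw [lo_raise, hi_raise]
    have h := ih hf.2
    rw [show d - 1 + 1 = d + 1 - 1 by ring] at h
    exact ⟨ih hf.1, add_mem h (Submodule.smul_mem _ _ (by simpa using hf.1))⟩

lemma raise_pow_mem {d : ℤ} {f : Cube F n} (hf : f ∈ forms F n d) (k : ℕ) :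
    (raise e n ^ k) f ∈ forms F n (d + k) := by
  induction k with
  | zero => simpa using hf
  | succ k ih =>
    rw [pow_succ', Module.End.mul_apply, show d + ((k + 1 : ℕ) : ℤ) = d + k + 1 by push_cast; ring]
    exact raise_mem ih

lemma lower_congr (h : ∀ i < n, a i = b i) : lower a n = lower b n := by
  induction n with
  | zero => rfl
  | succ n ih => rw [lower, lower, ih fun i hi => h i (by omega), h n (by omega)]

/-- The operators `∑ a_i ∂/∂x_i` and `∑ a_i⁻¹ x_i` generate an action of `sl₂`. -/
lemma lower_raise (hae : ∀ i < n, a i * e i = 1) {d : ℤ} {f : Cube F n} (hf : f ∈ forms F n d) :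
    lower a n (raise e n f) = raise e n (lower a n f) + ((n : F) - 2 * (d : F)) • f := by
  induction n generalizing d with
  | zero =>
    rcases eq_or_ne d 0 with rfl | hd
    · simp
    · simp [forms_zero_eq_zero hd hf]
  | succ n ih =>
    have ih' := fun {d : ℤ} {f : Cube F n} => ih (fun i hi => hae i (by omega)) (d := d) (f := f)
    rw [mem_forms_succ] at hf
    have hn := hae n (by omega)
    refine ext_lo_hi ?_ ?_
    · simp only [lo_lower, lo_raise, hi_raise, map_add, map_smul, ih' hf.1, smul_add, smul_smul, hn]
      push_cast
      module
    · simp only [hi_lower, lo_lower, hi_raise, map_add, map_smul, ih' hf.2, smul_add,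
        smul_smul, mul_comm (e n), hn]
      push_cast
      module

lemma lower_raise_pow (hae : ∀ i < n, a i * e i = 1) {d : ℤ} {f : Cube F n}
    (hf : f ∈ forms F n d) (m : ℕ) :
    lower a n ((raise e n ^ (m + 1)) f) = (raise e n ^ (m + 1)) (lower a n f) +
      ((m + 1 : F) * ((n : F) - 2 * (d : F) - m)) • (raise e n ^ m) f := by
  induction m with
  | zero => simpa using lower_raise hae hf
  | succ m ih =>
    rw [← apply_pow, lower_raise hae (raise_pow_mem hf (m + 1)), ih, map_add, map_smul,
      apply_pow, apply_pow]
    push_cast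
    module

variable [CharZero F]

/-- Hard Lefschetz for the Boolean cube, in the range where the power of the derivation is
injective. -/
lemma eq_zero_of_lower_pow (ha : ∀ i < n, a i ≠ 0) {d : ℤ} {k : ℕ} (hk : (n : ℤ) + k ≤ 2 * d)
    {f : Cube F n} (hf : f ∈ forms F n d) (h : (lower a n ^ k) f = 0) : f = 0 := by
  induction n generalizing d k with
  | zero =>
    rcases eq_or_ne d 0 with rfl | hd
    · obtain rfl : k = 0 := by omega
      simpa using h
    · exact forms_zero_eq_zero hd hf
  | succ n ih =>
    rcases k with _ | k
    · simpa using h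
    have ih' := fun {d : ℤ} {k : ℕ} => ih (fun i hi => ha i (by omega)) (d := d) (k := k)
    have hf' := mem_forms_succ.1 hf
    have h0 : (lower a n ^ (k + 2)) (lo n f) = 0 := by
      have := congrArg (lower a n) (congrArg (lo n) h)
      rw [lo_lower_pow, map_add, map_smul, apply_pow, apply_pow, ← hi_lower_pow, h] at this
      simpa using this
    have hlo : lo n f = 0 := ih' (k := k + 2) (by push_cast at hk ⊢; omega) hf'.1 h0
    have h1 : (lower a n ^ k) (hi n f) = 0 := by
      have := congrArg (lo n) h
      rw [lo_lower_pow, hlo, map_zero, map_zero, zero_add, smul_eq_zero] at this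
      exact this.resolve_left (mul_ne_zero (by exact_mod_cast k.succ_ne_zero) (ha n (by omega)))
    exact ext_lo_hi (by simpa using hlo)
      (by simpa using ih' (by push_cast at hk ⊢; omega) hf'.2 h1)

/-- In an `sl₂`-representation, being killed by the `k`-th power of the lowering operator is the
same as being killed by the opposite power of the raising operator, determined by the weight. -/
lemma raise_pow_eq_zero (hae : ∀ i < n, a i * e i = 1) {d : ℤ} {k m : ℕ}
    (hm : (m : ℤ) + 2 * d = n + k) {f : Cube F n} (hf : f ∈ forms F n d)
    (h : (lower a n ^ k) f = 0) : (raise e n ^ m) f = 0 := by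
  induction n generalizing d k m with
  | zero =>
    rcases eq_or_ne d 0 with rfl | hd
    · rcases k with _ | k
      · simp_all
      · obtain ⟨m, rfl⟩ : ∃ m', m = m' + 1 := ⟨m - 1, by omega⟩
        simp [pow_succ]
    · simp [forms_zero_eq_zero hd hf]
  | succ n ih =>
    rcases k with _ | k
    · rw [pow_zero, Module.End.one_apply] at h
      simp [h]
    have hae' : ∀ i < n, a i * e i = 1 := fun i hi => hae i (by omega)
    have hn := hae n (by omega)
    have hf' := mem_forms_succ.1 hf
    have hlow := congrArg (lo n) h
    rw [lo_lower_pow, map_zero] at hlow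
    have h0 : (lower a n ^ (k + 2)) (lo n f) = 0 := by
      have := congrArg (lower a n) hlow
      rw [map_add, map_smul, apply_pow, apply_pow, ← hi_lower_pow, h] at this
      simpa using this
    have hlo : (raise e n ^ m) (lo n f) = 0 :=
      ih hae' (k := k + 2) (by push_cast at hm ⊢; omega) hf'.1 h0
    -- The combination `D f₀ + k a_n f₁` is killed by one power of the derivation less.
    have hg : (raise e n ^ m) (lower a n (lo n f) + ((k + 1 : F) * a n) • hi n f) = 0 := by
      refine ih hae' (k := k) (d := d - 1) (by push_cast at hm ⊢; omega)
        (add_mem (lower_mem hf'.1) (Submodule.smul_mem _ _ hf'.2)) ?_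
      rwa [map_add, map_smul, ← Module.End.mul_apply, ← pow_succ]
    refine ext_lo_hi (by simpa using hlo) ?_
    have hk0 : (k + 1 : F) ≠ 0 := by exact_mod_cast k.succ_ne_zero
    have ha0 : a n ≠ 0 := left_ne_zero_of_mul_eq_one hn
    rcases m with _ | m
    · rw [pow_zero, Module.End.one_apply] at hlo hg ⊢
      rw [hlo, map_zero, zero_add, smul_eq_zero] at hg
      simpa using hg.resolve_left (mul_ne_zero hk0 ha0)
    · have hc := lower_raise_pow hae' hf'.1 m
      rw [hlo, map_zero] at hc
      have hmF : (m : F) + 1 + 2 * d = n + 1 + (k + 1) := by exact_mod_cast hm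
      rw [show (n : F) - 2 * d - m = -(k + 1) by linear_combination -hmF] at hc
      rw [hi_raise_pow, map_zero]
      rw [map_add, map_smul] at hg
      have key : ((k + 1 : F) * a n) • ((raise e n ^ (m + 1)) (hi n f) +
          ((m + 1 : F) * e n) • (raise e n ^ m) (lo n f)) = 0 := by
        rw [smul_add, smul_smul,
          show (k + 1 : F) * a n * ((m + 1) * e n) = (k + 1) * (m + 1) by
            linear_combination (k + 1 : F) * (m + 1) * hn]
        linear_combination (norm := module) hg + hc
      exact (smul_eq_zero.1 key).resolve_left (mul_ne_zero hk0 ha0)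

end
end Cube

namespace Cube

variable {F : Type*} [Field F] {n : ℕ}

/-! ### Dimensions -/

lemma finrank_le_add {M N N' : Type*} [AddCommGroup M] [Module F M] [AddCommGroup N] [Module F N]
    [AddCommGroup N'] [Module F N'] [FiniteDimensional F M] [FiniteDimensional F N]
    [FiniteDimensional F N'] (φ : M →ₗ[F] N) (ψ : M →ₗ[F] N') {X : Submodule F M}
    {Y : Submodule F N} {K : Submodule F N'} (hY : ∀ f ∈ X, φ f ∈ Y)
    (hK : ∀ f ∈ X, φ f = 0 → ψ f ∈ K) (hinj : ∀ f, φ f = 0 → ψ f = 0 → f = 0) :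
    Module.finrank F X ≤ Module.finrank F Y + Module.finrank F K := by
  have h := LinearMap.finrank_range_add_finrank_ker (φ.domRestrict X)
  have h1 : Module.finrank F (LinearMap.range (φ.domRestrict X)) ≤ Module.finrank F Y := by
    refine Submodule.finrank_mono ?_
    rintro _ ⟨f, rfl⟩
    exact hY f f.2
  have h2 : Module.finrank F (LinearMap.ker (φ.domRestrict X)) ≤ Module.finrank F K := by
    let χ : LinearMap.ker (φ.domRestrict X) →ₗ[F] K :=
      LinearMap.codRestrict K ((ψ ∘ₗ X.subtype) ∘ₗ (LinearMap.ker (φ.domRestrict X)).subtype)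
        fun f => hK _ f.1.2 f.2
    refine LinearMap.finrank_le_finrank_of_injective (f := χ) ?_
    rw [injective_iff_map_eq_zero]
    intro f hf
    exact Subtype.ext (Subtype.ext (hinj _ f.2 (congrArg Subtype.val hf)))
  omega

/-- Binomial coefficients with an integer lower index. -/
def binom : ℕ → ℤ → ℕ
  | 0, d => if d = 0 then 1 else 0
  | n + 1, d => binom n d + binom n (d - 1)

lemma finrank_forms (n : ℕ) (d : ℤ) : Module.finrank F (forms F n d) = binom n d := by
  induction n generalizing d with
  | zero =>
    rcases eq_or_ne d 0 with rfl | hd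
    · rw [show forms F 0 0 = ⊤ from eq_top_iff.2 fun f _ => mem_forms_zero_zero f]
      simp [binom]
    · rw [show forms F 0 d = ⊥ from (Submodule.eq_bot_iff _).2 fun f => forms_zero_eq_zero hd]
      simp [binom, hd]
  | succ n ih =>
    let φ : (forms F n d × forms F n (d - 1)) →ₗ[F] Cube F (n + 1) :=
      glue n ∘ₗ (forms F n d).subtype.prodMap (forms F n (d - 1)).subtype
    have hφ : Function.Injective φ := by
      intro p q h
      have h0 := congrArg (lo n) h
      have h1 := congrArg (hi n) h
      simp only [φ, LinearMap.comp_apply, lo_glue, hi_glue] at h0 h1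
      exact Prod.ext (Subtype.ext h0) (Subtype.ext h1)
    have hr : LinearMap.range φ = forms F (n + 1) d := by
      ext f
      rw [mem_forms_succ]
      constructor
      · rintro ⟨p, rfl⟩
        simp [φ]
      · rintro ⟨h0, h1⟩
        exact ⟨(⟨_, h0⟩, ⟨_, h1⟩), ext_lo_hi (by simp [φ]) (by simp [φ])⟩
    rw [← hr, LinearMap.finrank_range_of_inj hφ, Module.finrank_prod, ih, ih, binom]

lemma forms_eq_zero_of_neg {d : ℤ} (hd : d < 0) {f : Cube F n} (hf : f ∈ forms F n d) : f = 0 := by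
  ext s
  refine hf s (ne_of_gt (lt_of_lt_of_le hd (Finset.sum_nonneg fun i _ => ?_)))
  split_ifs <;> simp

/-- The forms of degree `d` killed by `(∑ a_i ∂/∂x_i) ^ k`. -/
def killed (a : ℕ → F) (n : ℕ) (d : ℤ) (k : ℕ) : Submodule F (Cube F n) :=
  forms F n d ⊓ LinearMap.ker (lower a n ^ k)

lemma mem_killed {a : ℕ → F} {d : ℤ} {k : ℕ} {f : Cube F n} :
    f ∈ killed a n d k ↔ f ∈ forms F n d ∧ (lower a n ^ k) f = 0 := Iff.rfl

lemma killed_zero (a : ℕ → F) (n : ℕ) (d : ℤ) : killed a n d 0 = ⊥ := by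
  rw [Submodule.eq_bot_iff]
  exact fun f hf => hf.2

lemma binom_le_finrank_killed (a : ℕ → F) (n : ℕ) (d : ℤ) (k : ℕ) :
    binom n d ≤ binom n (d - k) + Module.finrank F (killed a n d k) := by
  rw [← finrank_forms (F := F) n d, ← finrank_forms (F := F) n (d - k)]
  exact finrank_le_add (lower a n ^ k) LinearMap.id (fun f hf => lower_pow_mem hf k)
    (fun f hf h => ⟨hf, h⟩) fun f _ h => h

/-- Splitting off the last variable from a form killed by a power of a derivation. -/
lemma lo_mem_killed {a : ℕ → F} {d : ℤ} {k : ℕ} {f : Cube F (n + 1)}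
    (hf : f ∈ killed a (n + 1) d (k + 1)) : lo n f ∈ killed a n d (k + 2) := by
  obtain ⟨hf, h⟩ := mem_killed.1 hf
  refine ⟨(mem_forms_succ.1 hf).1, ?_⟩
  have := congrArg (lower a n) (congrArg (lo n) h)
  rw [lo_lower_pow, map_add, map_smul, apply_pow, apply_pow, ← hi_lower_pow, h] at this
  simpa using this

variable [CharZero F]

lemma hi_mem_killed {a : ℕ → F} (ha : a n ≠ 0) {d : ℤ} {k : ℕ} {f : Cube F (n + 1)}
    (hf : f ∈ killed a (n + 1) d (k + 1)) (h0 : lo n f = 0) : hi n f ∈ killed a n (d - 1) k := by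
  obtain ⟨hf, h⟩ := mem_killed.1 hf
  refine ⟨(mem_forms_succ.1 hf).2, ?_⟩
  have := congrArg (lo n) h
  rw [lo_lower_pow, h0, map_zero, map_zero, zero_add, smul_eq_zero] at this
  exact this.resolve_left (mul_ne_zero (by exact_mod_cast k.succ_ne_zero) ha)

/-- Hard Lefschetz for the Boolean cube, in the range where the power of the derivation is
surjective: the kernel is no larger than it has to be. -/
lemma finrank_killed_le {a : ℕ → F} (ha : ∀ i < n, a i ≠ 0) {d : ℤ} {k : ℕ}
    (h : 2 * d ≤ n + k) : Module.finrank F (killed a n d k) + binom n (d - k) ≤ binom n d := by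
  rcases k with _ | k
  · simp [killed_zero]
  induction n generalizing d k with
  | zero =>
    have h1 : Module.finrank F (killed a 0 d (k + 1)) ≤ Module.finrank F (forms F 0 d) :=
      Submodule.finrank_mono inf_le_left
    rw [finrank_forms] at h1
    have h2 : binom 0 (d - (k + 1 : ℕ)) = 0 := by
      rw [binom, if_neg]
      push_cast at h ⊢
      omega
    omega
  | succ n ih =>
    have ih' := fun {d : ℤ} {k : ℕ} => ih (fun i hi => ha i (by omega)) (d := d) (k := k)
    have h1 : Module.finrank F (killed a (n + 1) d (k + 1)) ≤
        Module.finrank F (killed a n d (k + 1 + 1)) + Module.finrank F (killed a n (d - 1) k) :=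
      finrank_le_add (lo n) (hi n) (fun f => lo_mem_killed)
        (fun f hf => hi_mem_killed (ha n (by omega)) hf)
        fun f h0 h1 => ext_lo_hi (by simpa using h0) (by simpa using h1)
    have h2 := ih' (d := d) (k := k + 1) (by push_cast at h ⊢; omega)
    have h3 : Module.finrank F (killed a n (d - 1) k) + binom n (d - 1 - k) ≤ binom n (d - 1) := by
      rcases k with _ | k
      · simp [killed_zero]
      · exact ih' (by push_cast at h ⊢; omega)
    rw [binom, binom]
    rw [show d - 1 - (k : ℤ) = d - (k + 1 : ℕ) by push_cast; ring] at h3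
    rw [show d - ((k + 1 + 1 : ℕ) : ℤ) = d - (k + 1 : ℕ) - 1 by push_cast; ring] at h2
    omega

end Cube

namespace Cube

variable {F : Type*} [Field F] {n : ℕ}

/-! ### The hidden relation -/

/-- The coefficient of `x_1 ⋯ x_n`. -/
def top (F : Type*) [Field F] (n : ℕ) : Cube F n →ₗ[F] F := LinearMap.proj fun _ => true

@[simp] lemma top_eq (f : Cube F (n + 1)) : top F (n + 1) f = top F n (hi n f) := by
  simp only [top, LinearMap.proj_apply, hi_apply]
  congr 1
  ext i
  refine Fin.lastCases ?_ (fun j => ?_) i <;> simp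

/-- `f` times the linear form `t₁ x_n + t₂ x_{n+1} + t₃ x_{n+2}` in three new variables. -/
def mulLinear (t₁ t₂ t₃ : F) (f : Cube F n) : Cube F (n + 3) :=
  glue _ (glue _ (glue _ (0, t₁ • f), glue _ (t₂ • f, 0)), glue _ (glue _ (t₃ • f, 0), 0))

/-- `f` times the quadric `t₁ x_{n+1} x_{n+2} + t₂ x_n x_{n+2} + t₃ x_n x_{n+1}` in three new
variables. -/
def mulQuadric (t₁ t₂ t₃ : F) (f : Cube F n) : Cube F (n + 3) :=
  glue _ (glue _ (0, glue _ (0, t₃ • f)), glue _ (glue _ (0, t₂ • f), glue _ (t₁ • f, 0)))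

/-- `f` times `t x_n x_{n+1} x_{n+2}`. -/
def mulCubic (t : F) (f : Cube F n) : Cube F (n + 3) :=
  glue _ (0, glue _ (0, glue _ (0, t • f)))

lemma ext_three {f g : Cube F (n + 3)}
    (h000 : lo n (lo _ (lo _ f)) = lo n (lo _ (lo _ g)))
    (h100 : hi n (lo _ (lo _ f)) = hi n (lo _ (lo _ g)))
    (h010 : lo n (hi _ (lo _ f)) = lo n (hi _ (lo _ g)))
    (h110 : hi n (hi _ (lo _ f)) = hi n (hi _ (lo _ g)))
    (h001 : lo n (lo _ (hi _ f)) = lo n (lo _ (hi _ g)))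
    (h101 : hi n (lo _ (hi _ f)) = hi n (lo _ (hi _ g)))
    (h011 : lo n (hi _ (hi _ f)) = lo n (hi _ (hi _ g)))
    (h111 : hi n (hi _ (hi _ f)) = hi n (hi _ (hi _ g))) : f = g :=
  ext_lo_hi (ext_lo_hi (ext_lo_hi h000 h100) (ext_lo_hi h010 h110))
    (ext_lo_hi (ext_lo_hi h001 h101) (ext_lo_hi h011 h111))

lemma lower_mulLinear {a : ℕ → F} {t₁ t₂ t₃ : F}
    (h : a n * t₁ + a (n + 1) * t₂ + a (n + 2) * t₃ = 0) (f : Cube F n) :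
    lower a (n + 3) (mulLinear t₁ t₂ t₃ f) = mulLinear t₁ t₂ t₃ (lower a n f) := by
  refine ext_three ?_ ?_ ?_ ?_ ?_ ?_ ?_ ?_ <;> simp [mulLinear]
  linear_combination (norm := module) congrArg (fun c => c • f) h

lemma raise_mulLinear (e : ℕ → F) (t₁ t₂ t₃ : F) (f : Cube F n) :
    raise e (n + 3) (mulLinear t₁ t₂ t₃ f) = mulLinear t₁ t₂ t₃ (raise e n f) +
      mulQuadric (t₂ * e (n + 2) + t₃ * e (n + 1)) (t₁ * e (n + 2) + t₃ * e n)
        (t₁ * e (n + 1) + t₂ * e n) f := by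
  refine ext_three ?_ ?_ ?_ ?_ ?_ ?_ ?_ ?_ <;> simp [mulLinear, mulQuadric] <;> module

lemma raise_mulQuadric (e : ℕ → F) (t₁ t₂ t₃ : F) (f : Cube F n) :
    raise e (n + 3) (mulQuadric t₁ t₂ t₃ f) = mulQuadric t₁ t₂ t₃ (raise e n f) +
      mulCubic (t₁ * e n + t₂ * e (n + 1) + t₃ * e (n + 2)) f := by
  refine ext_three ?_ ?_ ?_ ?_ ?_ ?_ ?_ ?_ <;> simp [mulCubic, mulQuadric]
  module

lemma raise_mulCubic (e : ℕ → F) (t : F) (f : Cube F n) :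
    raise e (n + 3) (mulCubic t f) = mulCubic t (raise e n f) := by
  refine ext_three ?_ ?_ ?_ ?_ ?_ ?_ ?_ ?_ <;> simp [mulCubic]

lemma mulCubic_zero_left (f : Cube F n) : mulCubic 0 f = 0 := by
  simp [mulCubic, ← Prod.zero_eq_mk]

lemma raise_pow_mulLinear {e : ℕ → F} {t₁ t₂ t₃ : F}
    (h : t₁ * (e (n + 1) * e (n + 2)) + t₂ * (e n * e (n + 2)) + t₃ * (e n * e (n + 1)) = 0)
    (m : ℕ) (f : Cube F n) :
    (raise e (n + 3) ^ (m + 1)) (mulLinear t₁ t₂ t₃ f) =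
      mulLinear t₁ t₂ t₃ ((raise e n ^ (m + 1)) f) + (m + 1 : F) •
      mulQuadric (t₂ * e (n + 2) + t₃ * e (n + 1)) (t₁ * e (n + 2) + t₃ * e n)
        (t₁ * e (n + 1) + t₂ * e n) ((raise e n ^ m) f) := by
  induction m with
  | zero => simp [raise_mulLinear]
  | succ m ih =>
    rw [← apply_pow, ih, map_add, map_smul, raise_mulLinear, raise_mulQuadric, apply_pow, apply_pow,
      show (t₂ * e (n + 2) + t₃ * e (n + 1)) * e n + (t₁ * e (n + 2) + t₃ * e n) * e (n + 1) +
        (t₁ * e (n + 1) + t₂ * e n) * e (n + 2) = 0 by linear_combination 2 * h,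
      mulCubic_zero_left]
    push_cast
    module

lemma raise_pow_mulQuadric (e : ℕ → F) (t₁ t₂ t₃ : F) (m : ℕ) (f : Cube F n) :
    (raise e (n + 3) ^ (m + 1)) (mulQuadric t₁ t₂ t₃ f) =
      mulQuadric t₁ t₂ t₃ ((raise e n ^ (m + 1)) f) + (m + 1 : F) •
      mulCubic (t₁ * e n + t₂ * e (n + 1) + t₃ * e (n + 2)) ((raise e n ^ m) f) := by
  induction m with
  | zero => simp [raise_mulQuadric]
  | succ m ih =>
    rw [← apply_pow, ih, map_add, map_smul, raise_mulQuadric, raise_mulCubic, apply_pow, apply_pow]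
    push_cast
    module

/-- Multiplying a form by the linear form in three new variables that both derivations kill adds
one factor of each of the two raising operators to a nonzero top coefficient. -/
lemma top_raise_pow_mulLinear {e e' : ℕ → F} {t₁ t₂ t₃ : F}
    (h : t₁ * (e (n + 1) * e (n + 2)) + t₂ * (e n * e (n + 2)) + t₃ * (e n * e (n + 1)) = 0)
    (h' : t₁ * (e' (n + 1) * e' (n + 2)) + t₂ * (e' n * e' (n + 2)) +
      t₃ * (e' n * e' (n + 1)) = 0) (m : ℕ) (f : Cube F n) :
    top F (n + 3) ((raise e (n + 3) ^ (m + 1)) ((raise e' (n + 3) ^ (m + 1))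
      (mulLinear t₁ t₂ t₃ f))) = (m + 1 : F) ^ 2 * (t₁ * (e (n + 1) * e' (n + 2) +
        e (n + 2) * e' (n + 1)) + t₂ * (e n * e' (n + 2) + e (n + 2) * e' n) +
        t₃ * (e n * e' (n + 1) + e (n + 1) * e' n)) *
      top F n ((raise e n ^ m) ((raise e' n ^ m) f)) := by
  rw [raise_pow_mulLinear h', map_add, map_smul, raise_pow_mulLinear h, raise_pow_mulQuadric]
  simp [mulLinear, mulQuadric, mulCubic]
  ring

/-- The form `x_1 x_2 T_1 ⋯ T_m`, each `T_k` being the linear form in three further variables that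
both derivations kill. It is killed by the product of the squares of the derivations, since the
factor `x_1 x_2` has degree `2 < 4`. -/
lemma exists_top_raise_pow_ne_zero [CharZero F] (a b e e' : ℕ → F) (m : ℕ)
    (hae : ∀ i < 3 * m + 2, a i * e i = 1) (hbe : ∀ i < 3 * m + 2, b i * e' i = 1)
    (hab : ∀ i < 3 * m + 2, ∀ j < i, a i * b j - a j * b i ≠ 0) :
    ∃ f ∈ forms F (3 * m + 2) (m + 2 : ℕ),
      (lower a (3 * m + 2) ^ 2) ((lower b (3 * m + 2) ^ 2) f) = 0 ∧
      top F (3 * m + 2) ((raise e (3 * m + 2) ^ m) ((raise e' (3 * m + 2) ^ m) f)) ≠ 0 := by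
  induction m with
  | zero =>
    have hf : (Pi.single (fun _ => true) 1 : Cube F 2) ∈ forms F 2 (2 : ℕ) := by
      intro s hs
      rw [Pi.single_eq_of_ne]
      rintro rfl
      simp [weight] at hs
    exact ⟨_, hf, forms_eq_zero_of_neg (by norm_num) (lower_pow_mem (lower_pow_mem hf 2) 2),
      by simp [top]⟩
  | succ m ih =>
    rw [show 3 * (m + 1) + 2 = 3 * m + 2 + 3 by ring] at hae hbe hab ⊢
    obtain ⟨f, hf, h0, h1⟩ := ih (fun i hi => hae i (by omega)) (fun i hi => hbe i (by omega))
      fun i hi => hab i (by omega)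
    clear ih
    generalize 3 * m + 2 = n at *
    have ha0 := hae n (by omega)
    have ha1 := hae (n + 1) (by omega)
    have ha2 := hae (n + 2) (by omega)
    have hb0 := hbe n (by omega)
    have hb1 := hbe (n + 1) (by omega)
    have hb2 := hbe (n + 2) (by omega)
    have h10 := hab (n + 1) (by omega) n (by omega)
    have h20 := hab (n + 2) (by omega) n (by omega)
    have h21 := hab (n + 2) (by omega) (n + 1) (by omega)
    -- The coefficients of the common linear form are a cross product.
    let t₁ := a (n + 1) * b (n + 2) - a (n + 2) * b (n + 1)
    let t₂ := a (n + 2) * b n - a n * b (n + 2)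
    let t₃ := a n * b (n + 1) - a (n + 1) * b n
    have hta : a n * t₁ + a (n + 1) * t₂ + a (n + 2) * t₃ = 0 := by simp only [t₁, t₂, t₃]; ring
    have htb : b n * t₁ + b (n + 1) * t₂ + b (n + 2) * t₃ = 0 := by simp only [t₁, t₂, t₃]; ring
    have hlow : ∀ (c : ℕ → F), c n * t₁ + c (n + 1) * t₂ + c (n + 2) * t₃ = 0 → ∀ g : Cube F n,
        (lower c (n + 3) ^ 2) (mulLinear t₁ t₂ t₃ g) = mulLinear t₁ t₂ t₃ ((lower c n ^ 2) g) := by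
      intro c hc g
      simp [pow_two, lower_mulLinear hc]
    refine ⟨mulLinear t₁ t₂ t₃ f, ?_, ?_, ?_⟩
    · have hf' : f ∈ forms F n ((m + 1 + 2 : ℕ) - 1) := by
        rw [show ((m + 1 + 2 : ℕ) : ℤ) - 1 = (m + 2 : ℕ) by push_cast; ring]
        exact hf
      simp only [mem_forms_succ, mulLinear, lo_glue, hi_glue, zero_mem, and_true, true_and]
      exact ⟨⟨Submodule.smul_mem _ _ hf', Submodule.smul_mem _ _ hf'⟩, Submodule.smul_mem _ _ hf'⟩
    · rw [hlow b htb, hlow a hta, h0]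
      simp [mulLinear, ← Prod.zero_eq_mk]
    · rw [top_raise_pow_mulLinear]
      · have hm : (m + 1 : F) ≠ 0 := by exact_mod_cast m.succ_ne_zero
        refine mul_ne_zero (mul_ne_zero (pow_ne_zero 2 hm) ?_) h1
        have hane : ∀ i < n + 3, a i ≠ 0 := fun i hi => left_ne_zero_of_mul_eq_one (hae i hi)
        have hbne : ∀ i < n + 3, b i ≠ 0 := fun i hi => left_ne_zero_of_mul_eq_one (hbe i hi)
        have he : ∀ i < n + 3, e i = (a i)⁻¹ := fun i hi => eq_inv_of_mul_eq_one_right (hae i hi)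
        have he' : ∀ i < n + 3, e' i = (b i)⁻¹ := fun i hi => eq_inv_of_mul_eq_one_right (hbe i hi)
        have := hane n (by omega)
        have := hane (n + 1) (by omega)
        have := hane (n + 2) (by omega)
        have := hbne n (by omega)
        have := hbne (n + 1) (by omega)
        have := hbne (n + 2) (by omega)
        -- After clearing denominators the coefficient is a Vandermonde determinant.
        have key : t₁ * (e (n + 1) * e' (n + 2) + e (n + 2) * e' (n + 1)) +
            t₂ * (e n * e' (n + 2) + e (n + 2) * e' n) +
            t₃ * (e n * e' (n + 1) + e (n + 1) * e' n) =
            (a (n + 1) * b n - a n * b (n + 1)) * (a (n + 2) * b n - a n * b (n + 2)) *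
              (a (n + 2) * b (n + 1) - a (n + 1) * b (n + 2)) *
              (e n * e (n + 1) * e (n + 2) * e' n * e' (n + 1) * e' (n + 2)) := by
          simp only [t₁, t₂, t₃, he n (by omega), he (n + 1) (by omega), he (n + 2) (by omega),
            he' n (by omega), he' (n + 1) (by omega), he' (n + 2) (by omega)]
          field_simp
          ring
        rw [key]
        refine mul_ne_zero (mul_ne_zero (mul_ne_zero h10 h20) h21) ?_
        exact mul_ne_zero (mul_ne_zero (mul_ne_zero (mul_ne_zero (mul_ne_zero
          (right_ne_zero_of_mul_eq_one ha0) (right_ne_zero_of_mul_eq_one ha1))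
          (right_ne_zero_of_mul_eq_one ha2)) (right_ne_zero_of_mul_eq_one hb0))
          (right_ne_zero_of_mul_eq_one hb1)) (right_ne_zero_of_mul_eq_one hb2)
      · linear_combination (e n * e (n + 1) * e (n + 2)) * hta - t₁ * e (n + 1) * e (n + 2) * ha0 -
          t₂ * e n * e (n + 2) * ha1 - t₃ * e n * e (n + 1) * ha2
      · linear_combination (e' n * e' (n + 1) * e' (n + 2)) * htb -
          t₁ * e' (n + 1) * e' (n + 2) * hb0 - t₂ * e' n * e' (n + 2) * hb1 -
          t₃ * e' n * e' (n + 1) * hb2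

/-- The lower bound. The functional `θ f = top (E ^ m (E' ^ m f))`, with `E` and `E'` the raising
operators of the two `sl₂`-actions, vanishes on the kernels of both squared derivations `D ^ 2` and
`D' ^ 2`, but not on the kernel of `D ^ 2 D' ^ 2`. So the sum of the first two kernels is smaller
than the third, and their intersection is larger than the naive count. -/
theorem binom_le_finrank_inf_killed [CharZero F] {a b : ℕ → F} {m : ℕ}
    (ha : ∀ i < 3 * m + 2, a i ≠ 0) (hb : ∀ i < 3 * m + 2, b i ≠ 0)
    (hab : ∀ i < 3 * m + 2, ∀ j < i, a i * b j - a j * b i ≠ 0) :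
    1 + binom (3 * m + 2) (m + 2) + binom (3 * m + 2) (m - 2) ≤
      Module.finrank F ↥(killed a (3 * m + 2) (m + 2) 2 ⊓ killed b (3 * m + 2) (m + 2) 2) +
        2 * binom (3 * m + 2) m := by
  have hae : ∀ i < 3 * m + 2, a i * (a i)⁻¹ = 1 := fun i hi => mul_inv_cancel₀ (ha i hi)
  have hbe : ∀ i < 3 * m + 2, b i * (b i)⁻¹ = 1 := fun i hi => mul_inv_cancel₀ (hb i hi)
  obtain ⟨f, hf, h0, h1⟩ := exists_top_raise_pow_ne_zero a b (fun i => (a i)⁻¹) (fun i => (b i)⁻¹) m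
    hae hbe hab
  push_cast at hf
  generalize hn : 3 * m + 2 = n at *
  have hnm : (n : ℤ) = 3 * m + 2 := by exact_mod_cast hn.symm
  let Z : Submodule F (Cube F n) :=
    forms F n (m + 2) ⊓ LinearMap.ker (lower a n ^ 2 * lower b n ^ 2)
  let θ : Cube F n →ₗ[F] F :=
    top F n ∘ₗ (raise (fun i => (a i)⁻¹) n ^ m * raise (fun i => (b i)⁻¹) n ^ m)
  have hZ : Module.finrank F Z ≤ Module.finrank F (killed a n m 2) +
      Module.finrank F (killed b n (m + 2) 2) := by
    refine finrank_le_add (lower b n ^ 2) LinearMap.id (fun g hg => ⟨?_, hg.2⟩)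
      (fun g hg h => ⟨hg.1, h⟩) fun g _ h => h
    simpa using lower_pow_mem (a := b) hg.1 2
  have hle : killed a n (m + 2) 2 ⊔ killed b n (m + 2) 2 ≤ Z ⊓ LinearMap.ker θ := by
    refine sup_le (fun g hg => ⟨⟨hg.1, ?_⟩, ?_⟩) fun g hg => ⟨⟨hg.1, ?_⟩, ?_⟩
    · have h : (lower a n ^ 2) g = 0 := hg.2
      rw [SetLike.mem_coe, LinearMap.mem_ker, ((lower_comm a b).pow_pow 2 2).eq,
        Module.End.mul_apply, h, map_zero]
    · have h : (raise (fun i => (a i)⁻¹) n ^ m) g = 0 :=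
        raise_pow_eq_zero hae (by push_cast; linarith) hg.1 hg.2
      rw [SetLike.mem_coe, LinearMap.mem_ker, LinearMap.comp_apply,
        ((raise_comm _ _).pow_pow m m).eq,
        Module.End.mul_apply, h, map_zero, map_zero]
    · have h : (lower b n ^ 2) g = 0 := hg.2
      rw [SetLike.mem_coe, LinearMap.mem_ker, Module.End.mul_apply, h, map_zero]
    · have h : (raise (fun i => (b i)⁻¹) n ^ m) g = 0 :=
        raise_pow_eq_zero hbe (by push_cast; linarith) hg.1 hg.2
      rw [SetLike.mem_coe, LinearMap.mem_ker, LinearMap.comp_apply,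
        Module.End.mul_apply, h, map_zero, map_zero]
  have hlt : Z ⊓ LinearMap.ker θ < Z :=
    lt_of_le_of_ne inf_le_left fun h => h1 (inf_eq_left.1 h (show f ∈ Z from ⟨hf, h0⟩))
  have hlt' := Submodule.finrank_lt_finrank_of_lt (lt_of_le_of_lt hle hlt)
  have hsum := Submodule.finrank_sup_add_finrank_inf_eq (killed a n (m + 2) 2)
    (killed b n (m + 2) 2)
  have hka := binom_le_finrank_killed a n (m + 2) 2
  have hkb := finrank_killed_le hb (d := m + 2) (k := 2) (by push_cast; linarith)
  have hkm := finrank_killed_le ha (d := m) (k := 2) (by push_cast; linarith)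
  rw [show (m : ℤ) + 2 - (2 : ℕ) = m by push_cast; ring] at hka hkb
  rw [show (m : ℤ) - (2 : ℕ) = m - 2 by push_cast; ring] at hkm
  omega

end Cube

/-! ### Generic pairs of coefficient sequences -/

section

variable {F : Type*} [Field F]

/-- The property `Q` holds for a generic pair of coefficient sequences: it holds wherever a certain
nonzero polynomial does not vanish. -/
def Generic (Q : (ℕ → F) → (ℕ → F) → Prop) : Prop :=
  ∃ G : MvPolynomial (ℕ ⊕ ℕ) F, G ≠ 0 ∧ ∀ a b, eval (Sum.elim a b) G ≠ 0 → Q a b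

/-- The scalar `φ a b` depends polynomially on the coefficient sequences `a` and `b`. -/
def IsPolyFun (φ : (ℕ → F) → (ℕ → F) → F) : Prop :=
  ∃ P : MvPolynomial (ℕ ⊕ ℕ) F, ∀ a b, eval (Sum.elim a b) P = φ a b

namespace Generic

variable {Q R : (ℕ → F) → (ℕ → F) → Prop}

lemma mono (h : Generic Q) (hQR : ∀ a b, Q a b → R a b) : Generic R := by
  obtain ⟨G, hG, h⟩ := h
  exact ⟨G, hG, fun a b hab => hQR a b (h a b hab)⟩

lemma of_forall (h : ∀ a b, Q a b) : Generic Q := ⟨1, one_ne_zero, fun a b _ => h a b⟩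

lemma and (hQ : Generic Q) (hR : Generic R) : Generic fun a b => Q a b ∧ R a b := by
  obtain ⟨G, hG, hQ⟩ := hQ
  obtain ⟨H, hH, hR⟩ := hR
  refine ⟨G * H, mul_ne_zero hG hH, fun a b hab => ?_⟩
  rw [map_mul] at hab
  exact ⟨hQ a b (left_ne_zero_of_mul hab), hR a b (right_ne_zero_of_mul hab)⟩

lemma forall_lt {Q : ℕ → (ℕ → F) → (ℕ → F) → Prop} (n : ℕ) (h : ∀ i < n, Generic (Q i)) :
    Generic fun a b => ∀ i < n, Q i a b := by
  induction n with
  | zero => exact of_forall fun a b i hi => absurd hi (by omega)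
  | succ n ih =>
    refine ((ih fun i hi => h i (by omega)).and (h n (by omega))).mono fun a b hab i hi => ?_
    rcases Nat.lt_succ_iff_lt_or_eq.1 hi with hi | rfl
    · exact hab.1 i hi
    · exact hab.2

lemma of_isPoly {φ : (ℕ → F) → (ℕ → F) → F} (hφ : IsPolyFun φ) (a₀ b₀ : ℕ → F)
    (h : φ a₀ b₀ ≠ 0) : Generic fun a b => φ a b ≠ 0 := by
  obtain ⟨P, hP⟩ := hφ
  refine ⟨P, ?_, fun a b hab => by rwa [hP] at hab⟩
  rintro rfl
  exact h (by simp [← hP])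

lemma exists_pair [Infinite F] (h : Generic Q) : ∃ a b, Q a b := by
  obtain ⟨G, hG, h⟩ := h
  by_contra! hQ
  refine hG (MvPolynomial.funext fun z => ?_)
  rw [map_zero, ← Sum.elim_comp_inl_inr z]
  by_contra hz
  exact hQ _ _ (h _ _ hz)

end Generic

namespace IsPolyFun

variable {φ ψ : (ℕ → F) → (ℕ → F) → F}

lemma const (c : F) : IsPolyFun fun _ _ => c := ⟨C c, by simp⟩

lemma left (i : ℕ) : IsPolyFun fun a _ : ℕ → F => a i := ⟨X (Sum.inl i), by simp⟩

lemma right (i : ℕ) : IsPolyFun fun _ b : ℕ → F => b i := ⟨X (Sum.inr i), by simp⟩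

lemma add (hφ : IsPolyFun φ) (hψ : IsPolyFun ψ) : IsPolyFun fun a b => φ a b + ψ a b := by
  obtain ⟨P, hP⟩ := hφ
  obtain ⟨Q, hQ⟩ := hψ
  exact ⟨P + Q, by simp [hP, hQ]⟩

lemma sub (hφ : IsPolyFun φ) (hψ : IsPolyFun ψ) : IsPolyFun fun a b => φ a b - ψ a b := by
  obtain ⟨P, hP⟩ := hφ
  obtain ⟨Q, hQ⟩ := hψ
  exact ⟨P - Q, by simp [hP, hQ]⟩

lemma mul (hφ : IsPolyFun φ) (hψ : IsPolyFun ψ) : IsPolyFun fun a b => φ a b * ψ a b := by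
  obtain ⟨P, hP⟩ := hφ
  obtain ⟨Q, hQ⟩ := hψ
  exact ⟨P * Q, by simp [hP, hQ]⟩

lemma sum {ι : Type*} (s : Finset ι) {φ : ι → (ℕ → F) → (ℕ → F) → F}
    (h : ∀ i ∈ s, IsPolyFun (φ i)) : IsPolyFun fun a b => ∑ i ∈ s, φ i a b := by
  classical
  induction s using Finset.induction_on with
  | empty => simpa using const 0
  | insert i s hi ih =>
    simp only [Finset.sum_insert hi]
    exact (h i (by simp)).add (ih fun j hj => h j (by simp [hj]))

lemma det {ι : Type*} [Fintype ι] [DecidableEq ι] {M : (ℕ → F) → (ℕ → F) → Matrix ι ι F}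
    (h : ∀ i j, IsPolyFun fun a b => M a b i j) : IsPolyFun fun a b => (M a b).det := by
  choose P hP using h
  refine ⟨(Matrix.of P).det, fun a b => ?_⟩
  rw [RingHom.map_det]
  congr 1
  ext i j
  simp [hP]

end IsPolyFun

/-- Semicontinuity of the kernel of a linear map that depends polynomially on parameters. -/
lemma Generic.finrank_ker_le {M N : Type*} [AddCommGroup M] [Module F M] [FiniteDimensional F M]
    [AddCommGroup N] [Module F N] {L : (ℕ → F) → (ℕ → F) → M →ₗ[F] N}
    (hL : ∀ m (φ : N →ₗ[F] F), IsPolyFun fun a b => φ (L a b m)) (a₀ b₀ : ℕ → F) :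
    Generic fun a b => Module.finrank F (LinearMap.ker (L a b)) ≤
      Module.finrank F (LinearMap.ker (L a₀ b₀)) := by
  -- A projection `c` onto the special kernel makes `(L, c)` injective at the special point, with
  -- left inverse `π`; the locus where `π ∘ (L, c)` is invertible is open.
  obtain ⟨c, hc⟩ := LinearMap.exists_leftInverse_of_injective
    (LinearMap.ker (L a₀ b₀)).subtype (Submodule.ker_subtype _)
  obtain ⟨π, hπ⟩ := LinearMap.exists_leftInverse_of_injective ((L a₀ b₀).prod c) (by
    rw [LinearMap.ker_eq_bot']
    intro m hm
    have h0 : L a₀ b₀ m = 0 := congrArg Prod.fst hm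
    have h1 : c m = 0 := congrArg Prod.snd hm
    have h2 := LinearMap.congr_fun hc ⟨m, h0⟩
    simp only [LinearMap.comp_apply, Submodule.subtype_apply, h1, LinearMap.id_apply] at h2
    exact (congrArg Subtype.val h2).symm)
  let B := Module.finBasis F M
  have hpoly : IsPolyFun fun a b => (LinearMap.toMatrix B B (π ∘ₗ (L a b).prod c)).det := by
    refine IsPolyFun.det fun i j => ?_
    have h := (hL (B j) ((B.coord i ∘ₗ π) ∘ₗ LinearMap.inl F _ _)).add
      (IsPolyFun.const ((B.coord i) (π (0, c (B j)))))
    convert h using 3 with a b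
    simp only [LinearMap.toMatrix_apply, LinearMap.comp_apply, LinearMap.inl_apply, ← map_add]
    simp [Module.Basis.coord_apply]
  refine (Generic.of_isPoly hpoly a₀ b₀ (by rw [hπ]; simp)).mono fun a b hdet => ?_
  have hinj : Function.Injective (π ∘ₗ (L a b).prod c) := by
    rw [LinearMap.det_toMatrix] at hdet
    exact ((LinearEquiv.ofIsUnitDet (v := B) (v' := B) (f := π ∘ₗ (L a b).prod c)
      (by rw [LinearMap.det_toMatrix]; exact hdet.isUnit)).injective)
  refine LinearMap.finrank_le_finrank_of_injective (f := c ∘ₗ (LinearMap.ker (L a b)).subtype) ?_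
  rw [injective_iff_map_eq_zero]
  rintro ⟨m, hm⟩ h
  have h' : c m = 0 := h
  refine Subtype.ext (hinj ?_)
  rw [LinearMap.mem_ker] at hm
  simp [hm, h']

namespace Cube

variable {n : ℕ}

lemma isPoly_of_apply {v : (ℕ → F) → (ℕ → F) → Cube F n} (h : ∀ s, IsPolyFun fun a b => v a b s)
    (φ : Cube F n →ₗ[F] F) : IsPolyFun fun a b => φ (v a b) := by
  have h1 : ∀ a b, φ (v a b) = ∑ s, v a b s * φ (Pi.single s 1) := fun a b => by
    conv_lhs => rw [pi_eq_sum_univ' (v a b)]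
    simp [map_sum]
  simp only [h1]
  exact IsPolyFun.sum _ fun s _ => (h s).mul (IsPolyFun.const _)

lemma isPoly_lower {c : (ℕ → F) → (ℕ → F) → ℕ → F} (hc : ∀ i, IsPolyFun fun a b => c a b i)
    {v : (ℕ → F) → (ℕ → F) → Cube F n} (h : ∀ s, IsPolyFun fun a b => v a b s) (s : Fin n → Bool) :
    IsPolyFun fun a b => lower (c a b) n (v a b) s := by
  induction n with
  | zero => simpa using IsPolyFun.const 0
  | succ n ih =>
    rw [← Fin.snoc_init_self (α := fun _ => Bool) s]
    have hlo := ih (v := fun a b => lo n (v a b)) (fun s => h _) (Fin.init s)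
    have hhi := ih (v := fun a b => hi n (v a b)) (fun s => h _) (Fin.init s)
    cases s (Fin.last n)
    · simp only [← lo_apply, lo_lower, Pi.add_apply, Pi.smul_apply, smul_eq_mul]
      exact hlo.add ((hc n).mul (h _))
    · simp only [← hi_apply, hi_lower]
      exact hhi

lemma isPoly_lower_pow {c : (ℕ → F) → (ℕ → F) → ℕ → F} (hc : ∀ i, IsPolyFun fun a b => c a b i)
    (k : ℕ) (f : Cube F n) (s : Fin n → Bool) :
    IsPolyFun fun a b => (lower (c a b) n ^ k) f s := by
  induction k generalizing s with
  | zero => simpa using IsPolyFun.const (f s)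
  | succ k ih =>
    simp only [← apply_pow]
    exact isPoly_lower hc ih s

lemma generic_finrank_inf_killed_le (n : ℕ) (d : ℤ) (k l : ℕ) (a₀ b₀ : ℕ → F) :
    Generic fun a b : ℕ → F => Module.finrank F ↥(killed a n d k ⊓ killed b n d l) ≤
      Module.finrank F ↥(killed a₀ n d k ⊓ killed b₀ n d l) := by
  let L : (ℕ → F) → (ℕ → F) → forms F n d →ₗ[F] Cube F n × Cube F n := fun a b =>
    ((lower a n ^ k).prod (lower b n ^ l)) ∘ₗ (forms F n d).subtype
  have hker : ∀ a b, Module.finrank F (LinearMap.ker (L a b)) =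
      Module.finrank F ↥(killed a n d k ⊓ killed b n d l) := by
    intro a b
    have hr : LinearMap.range ((forms F n d).subtype ∘ₗ (LinearMap.ker (L a b)).subtype) =
        killed a n d k ⊓ killed b n d l := by
      ext f
      constructor
      · rintro ⟨f, rfl⟩
        exact ⟨⟨f.1.2, congrArg Prod.fst f.2⟩, f.1.2, congrArg Prod.snd f.2⟩
      · rintro ⟨⟨h, h1⟩, -, h2⟩
        exact ⟨⟨⟨f, h⟩, Prod.ext h1 h2⟩, rfl⟩
    rw [← hr, LinearMap.finrank_range_of_inj (Subtype.val_injective.comp Subtype.val_injective)]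
  have h := Generic.finrank_ker_le (L := L) (fun f φ => ?_) a₀ b₀
  · simpa only [hker] using h
  · have h1 : ∀ a b, φ (L a b f) = (φ ∘ₗ LinearMap.inl F _ _) ((lower a n ^ k) f) +
        (φ ∘ₗ LinearMap.inr F _ _) ((lower b n ^ l) f) := fun a b => by
      simp only [LinearMap.comp_apply, ← map_add]
      simp [L]
    simp only [h1]
    exact (isPoly_of_apply (isPoly_lower_pow IsPolyFun.left k f.1) _).add
      (isPoly_of_apply (isPoly_lower_pow IsPolyFun.right l f.1) _)

end Cube

/-- The number of walks on the integers with `m` steps `±1` from `0` to `e` that stay in the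
interval `[0, w]`. -/
def stripPaths (w : ℤ) : ℕ → ℤ → ℕ
  | 0, e => if e = 0 ∧ 0 ≤ w then 1 else 0
  | m + 1, e => if 0 ≤ e ∧ e ≤ w then stripPaths w m (e - 1) + stripPaths w m (e + 1) else 0

namespace Cube

variable {n : ℕ}

/-- If `a_n = 0` and `b_n ≠ 0`, then splitting off the last variable bounds the common kernel by two
common kernels in one variable less. -/
lemma finrank_inf_killed_succ_le [CharZero F] {a b : ℕ → F} (ha : a n = 0) (hb : b n ≠ 0)
    (d : ℤ) (k : ℕ) :
    Module.finrank F ↥(killed a (n + 1) d 2 ⊓ killed b (n + 1) d (k + 1)) ≤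
      Module.finrank F ↥(killed a n d 2 ⊓ killed b n d (k + 2)) +
        Module.finrank F ↥(killed a n (d - 1) 2 ⊓ killed b n (d - 1) k) := by
  refine finrank_le_add (lo n) (hi n) (fun f hf => ⟨⟨?_, ?_⟩, lo_mem_killed hf.2⟩)
    (fun f hf h0 => ⟨⟨?_, ?_⟩, hi_mem_killed hb hf.2 h0⟩)
    fun f h0 h1 => ext_lo_hi (by simpa using h0) (by simpa using h1)
  · exact (mem_forms_succ.1 hf.1.1).1
  · have h := congrArg (lo n) (mem_killed.1 hf.1).2
    rw [lo_lower_pow, ha] at h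
    simpa using h
  · exact (mem_forms_succ.1 hf.1.1).2
  · have h := congrArg (hi n) (mem_killed.1 hf.1).2
    rw [hi_lower_pow] at h
    simpa using h

/-- The upper bound: the recursion of `finrank_inf_killed_succ_le` for special coefficients is the
one that counts walks in a strip by their last step, and semicontinuity passes from special to
generic coefficients. The walk is cut off at `0` since the Lefschetz property of the first form
makes the kernel vanish there, and at the other end of the strip since `k` reaches `0`. -/
theorem generic_finrank_le_stripPaths [CharZero F] (n : ℕ) (d : ℤ) (k : ℕ) :
    Generic fun a b : ℕ → F => Module.finrank F ↥(killed a n d 2 ⊓ killed b n d k) ≤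
      stripPaths (n - 2 * d + k) (n + 1) (n - 2 * d + 1) := by
  induction n generalizing d k with
  | zero =>
    refine Generic.of_forall fun a b => ?_
    rcases eq_or_ne d 0 with rfl | hd
    · rcases k with _ | k
      · rw [killed_zero, inf_bot_eq, finrank_bot]
        exact Nat.zero_le _
      · refine (Submodule.finrank_le _).trans ?_
        have hw : ((0 : ℕ) : ℤ) - 2 * 0 + (k + 1 : ℕ) = k + 1 := by push_cast; ring
        rw [hw, stripPaths, if_pos (by omega), stripPaths, stripPaths,
          if_pos (by omega)]
        simp
    · have hbot : killed a 0 d 2 ⊓ killed b 0 d k = ⊥ :=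
        (Submodule.eq_bot_iff _).2 fun f hf => forms_zero_eq_zero hd hf.1.1
      rw [hbot, finrank_bot]
      exact Nat.zero_le _
  | succ n ih =>
    by_cases he : (n : ℤ) + 2 - 2 * d < 0
    · have hne : Generic fun a _ : ℕ → F => ∀ i < n + 1, a i ≠ 0 :=
        Generic.forall_lt _ fun i _ => Generic.of_isPoly (IsPolyFun.left i) 1 1 one_ne_zero
      refine hne.mono fun a b ha => ?_
      have hbot : killed a (n + 1) d 2 ⊓ killed b (n + 1) d k = ⊥ :=
        (Submodule.eq_bot_iff _).2 fun f hf =>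
          eq_zero_of_lower_pow ha (by push_cast; omega) hf.1.1 hf.1.2
      rw [hbot, finrank_bot]
      exact Nat.zero_le _
    · rcases k with _ | k
      · exact Generic.of_forall fun a b => by
          rw [killed_zero, inf_bot_eq, finrank_bot]
          exact Nat.zero_le _
      obtain ⟨a, b, h1, h2⟩ := ((ih d (k + 2)).and (ih (d - 1) k)).exists_pair
      have hup : ∀ (c : ℕ → F) (x : F), lower (Function.update c n x) n = lower c n :=
        fun c x => lower_congr fun i hi => Function.update_of_ne hi.ne _ _
      have hkl : ∀ (c : ℕ → F) (x : F) (d : ℤ) (k : ℕ),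
          killed (Function.update c n x) n d k = killed c n d k := fun c x d k => by
        rw [killed, hup, killed]
      have h := finrank_inf_killed_succ_le (n := n) (a := Function.update a n 0)
        (b := Function.update b n 1) (by simp) (by simp) d k
      rw [hkl, hkl, hkl, hkl] at h
      refine (generic_finrank_inf_killed_le (n + 1) d 2 (k + 1) (Function.update a n 0)
        (Function.update b n 1)).mono fun a' b' h' => h'.trans (h.trans ?_)
      rw [stripPaths, if_pos (by push_cast; omega)]
      convert add_le_add h1 h2 using 3 <;> push_cast <;> ring

end Cube

end

/-! ### Counting walks in a strip -/

lemma pathX_snoc_of_le {m : ℕ} (s : Fin m → Bool) (b : Bool) {j : ℕ} (hj : j ≤ m) :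
    pathX (Fin.snoc (α := fun _ => Bool) s b : Fin (m + 1) → Bool) j = pathX s j := by
  simp [pathX, Fin.sum_univ_castSucc, hj]

lemma pathX_snoc_last {m : ℕ} (s : Fin m → Bool) (b : Bool) :
    pathX (Fin.snoc (α := fun _ => Bool) s b : Fin (m + 1) → Bool) (m + 1) =
      pathX s m + if b then 1 else -1 := by
  simp only [pathX, Fin.sum_univ_castSucc, Fin.snoc_castSucc, Fin.snoc_last, Fin.val_castSucc,
    Fin.val_last, Nat.lt_succ_self, if_true]
  congr 1
  refine Finset.sum_congr rfl fun i _ => ?_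
  rw [if_pos (by omega), if_pos i.2]

lemma card_eq_stripPaths (w : ℤ) (m : ℕ) (e : ℤ) :
    (Finset.univ.filter fun s : Fin m → Bool =>
      pathX s m = e ∧ ∀ j ≤ m, 0 ≤ pathX s j ∧ pathX s j ≤ w).card = stripPaths w m e := by
  induction m generalizing e with
  | zero =>
    rw [Finset.card_filter, Fintype.sum_unique]
    have h0 : ∀ (s : Fin 0 → Bool) j, pathX s j = 0 := fun s j => rfl
    simp [h0, stripPaths, eq_comm (a := (0 : ℤ))]
  | succ m ih =>
    have hsnoc : ∀ (s : Fin m → Bool) (b : Bool),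
        (pathX (Fin.snoc (α := fun _ => Bool) s b : Fin (m + 1) → Bool) (m + 1) = e ∧
          ∀ j ≤ m + 1, 0 ≤ pathX (Fin.snoc (α := fun _ => Bool) s b : Fin (m + 1) → Bool) j ∧
            pathX (Fin.snoc (α := fun _ => Bool) s b : Fin (m + 1) → Bool) j ≤ w) ↔
        (0 ≤ e ∧ e ≤ w) ∧ (pathX s m = e - (if b then 1 else -1) ∧
          ∀ j ≤ m, 0 ≤ pathX s j ∧ pathX s j ≤ w) := by
      intro s b
      have hl := pathX_snoc_last s b
      constructor
      · rintro ⟨h, hj⟩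
        refine ⟨h ▸ hj (m + 1) le_rfl, by rw [← h, hl]; ring, fun j hjm => ?_⟩
        rw [← pathX_snoc_of_le s b hjm]
        exact hj j (by omega)
      · rintro ⟨he, h, hj⟩
        have hlast :
            pathX (Fin.snoc (α := fun _ => Bool) s b : Fin (m + 1) → Bool) (m + 1) = e := by
          rw [hl, h]
          ring
        refine ⟨hlast, fun j hjm => ?_⟩
        rcases Nat.le_succ_iff.1 hjm with hjm | rfl
        · rw [pathX_snoc_of_le s b hjm]
          exact hj j hjm
        · rwa [hlast]
    rw [Finset.card_filter, ← Equiv.sum_comp (Fin.snocEquiv fun _ => Bool),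
      Fintype.sum_prod_type, Fintype.sum_bool]
    simp only [Fin.snocEquiv, Equiv.coe_fn_mk, hsnoc, stripPaths]
    by_cases he : 0 ≤ e ∧ e ≤ w
    · rw [if_pos he, ← ih, ← ih, Finset.card_filter, Finset.card_filter]
      simp [he]
    · simp [he]

lemma pathCount_eq_stripPaths (n d : ℕ) :
    pathCount n d = stripPaths (n + 2 - 2 * d) (n + 2) (n + 2 - 2 * d) := by
  rw [← card_eq_stripPaths, pathCount]
  congr 1
  refine Finset.filter_congr fun s _ => ⟨fun h => h.2.2, fun h => ⟨?_, ?_, h⟩⟩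
  · have h1 : pathX s 1 = if s 0 then 1 else -1 := by
      simp [pathX]
    have h0 := (h.2 1 (by omega)).1
    by_contra hs
    simp [h1, hs] at h0
  · have h0 := (h.2 (n + 1) (by omega)).2
    have hX := h.1
    rw [← Fin.snoc_init_self (α := fun _ => Bool) s] at h0 hX
    rw [pathX_snoc_of_le _ _ le_rfl] at h0
    rw [pathX_snoc_last] at hX
    by_contra hs
    simp only [hs] at hX
    simp at hX
    omega

/-- The sum of the binomial coefficients whose lower index is congruent to `l` modulo `W`. -/
def perBinom (W : ℤ) : ℕ → ℤ → ℤ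
  | 0, l => if W ∣ l then 1 else 0
  | n + 1, l => perBinom W n l + perBinom W n (l - 1)

lemma perBinom_add_period (W : ℤ) (n : ℕ) (l : ℤ) : perBinom W n (l + W) = perBinom W n l := by
  induction n generalizing l with
  | zero => simp [perBinom]
  | succ n ih => rw [perBinom, perBinom, ih, add_sub_right_comm, ih]

lemma perBinom_symm (W : ℤ) (n : ℕ) (l : ℤ) : perBinom W n (n - l) = perBinom W n l := by
  induction n generalizing l with
  | zero => simp [perBinom]
  | succ n ih =>
    rw [perBinom, perBinom, ← ih l, ← ih (l - 1), add_comm]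
    push_cast
    ring_nf

/-- The reflection principle: the periodic alternating sum on the right satisfies Pascal's rule and
vanishes just outside the strip, by periodicity and symmetry. -/
lemma stripPaths_eq {w : ℤ} (hw : 0 ≤ w) (m : ℕ) (l : ℤ) (h0 : -1 ≤ m - 2 * l)
    (h1 : m - 2 * l ≤ w + 1) :
    (stripPaths w m (m - 2 * l) : ℤ) = perBinom (w + 2) m l - perBinom (w + 2) m (l - 1) := by
  induction m generalizing l with
  | zero =>
    have hl1 : ¬ (w + 2 ∣ l - 1) := by
      intro h
      have := Int.le_of_dvd (by push_cast at h0; omega) ((dvd_neg (a := w + 2) (b := l - 1)).2 h)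
      push_cast at h1
      omega
    rcases eq_or_ne l 0 with rfl | hl
    · simp only [zero_sub] at hl1
      simp [stripPaths, perBinom, hw, hl1]
    · have hl2 : ¬ (w + 2 ∣ l) := by
        intro h
        have := Int.le_of_dvd (by push_cast at h0; omega) ((dvd_neg (a := w + 2) (b := l)).2 h)
        push_cast at h1
        omega
      simp [stripPaths, perBinom, hl, hl1, hl2]
  | succ m ih =>
    by_cases he : 0 ≤ ((m + 1 : ℕ) : ℤ) - 2 * l ∧ ((m + 1 : ℕ) : ℤ) - 2 * l ≤ w
    · have e1 := ih l (by push_cast at he; omega) (by push_cast at he; omega)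
      have e2 := ih (l - 1) (by push_cast at he; omega) (by push_cast at he; omega)
      rw [stripPaths, if_pos he, perBinom, perBinom]
      rw [show ((m + 1 : ℕ) : ℤ) - 2 * l - 1 = m - 2 * l by push_cast; ring,
        show ((m + 1 : ℕ) : ℤ) - 2 * l + 1 = m - 2 * (l - 1) by push_cast; ring]
      push_cast
      rw [e1, e2]
      ring
    · rw [stripPaths, if_neg he, ← perBinom_symm (w + 2) (m + 1) l]
      rcases eq_or_lt_of_le h0 with h0 | h0
      · rw [show ((m + 1 : ℕ) : ℤ) - l = l - 1 by linarith]
        simp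
      · rw [show ((m + 1 : ℕ) : ℤ) - l = l - 1 + (w + 2) by omega, perBinom_add_period]
        simp

namespace Cube

lemma binom_of_neg (n : ℕ) {d : ℤ} (hd : d < 0) : binom n d = 0 := by
  induction n generalizing d with
  | zero => simp [binom, hd.ne]
  | succ n ih => simp [binom, ih hd, ih (show d - 1 < 0 by omega)]

lemma binom_symm (n : ℕ) (d : ℤ) : binom n (n - d) = binom n d := by
  induction n generalizing d with
  | zero => simp [binom]
  | succ n ih =>
    rw [binom, binom, ← ih d, ← ih (d - 1), add_comm]
    push_cast
    ring_nf

lemma binom_of_gt (n : ℕ) {d : ℤ} (hd : (n : ℤ) < d) : binom n d = 0 := by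
  rw [← binom_symm, binom_of_neg n (by omega)]

lemma binom_zero_right (n : ℕ) : binom n 0 = 1 := by
  induction n with
  | zero => simp [binom]
  | succ n ih => rw [binom, ih, binom_of_neg n (by norm_num)]

lemma perBinom_eq {W : ℤ} {n : ℕ} (hn : n < 3 * W) {l : ℤ} (h0 : 0 ≤ l) (h1 : l < W) :
    perBinom W n l = binom n l + binom n (l + W) + binom n (l + 2 * W) := by
  induction n generalizing l with
  | zero =>
    rcases eq_or_lt_of_le h0 with rfl | h0
    · simp [perBinom, binom, h1.ne']
    · have : ¬ W ∣ l := fun h => by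
        have := Int.le_of_dvd h0 h
        omega
      rw [perBinom, if_neg this, binom, binom, binom, if_neg (by omega), if_neg (by omega),
        if_neg (by omega)]
      simp
  | succ n ih =>
    push_cast at hn
    rw [perBinom, ih (by omega) h0 h1]
    simp only [binom]
    rcases eq_or_lt_of_le h0 with rfl | h0
    · rw [← perBinom_add_period, ih (by omega) (by omega) (by omega),
        binom_of_neg n (show (0 : ℤ) - 1 < 0 by norm_num),
        binom_of_gt n (show (n : ℤ) < 0 - 1 + W + 2 * W by linarith),
        show 0 - 1 + W = 0 + W - 1 by ring, show 0 + W - 1 + W = 0 + 2 * W - 1 by ring]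
      push_cast
      ring
    · rw [ih (by omega) (by omega) (by omega), show l - 1 + W = l + W - 1 by ring,
        show l - 1 + 2 * W = l + 2 * W - 1 by ring]
      push_cast
      ring

/-- For `n = 3d - 4`, here with `d = m + 2`, the reflection formula for the number of lattice paths
has only one term besides those of the naive count, namely `1`. -/
lemma pathCount_add (m : ℕ) :
    pathCount (3 * m + 2) (m + 2) + 2 * binom (3 * m + 2) m =
      1 + binom (3 * m + 2) (m + 2) + binom (3 * m + 2) (m - 2) := by
  have hp := perBinom_add_period (m + 2) (3 * m + 2) 0
  rw [perBinom_eq (W := m + 2) (l := 0) (by push_cast; omega) le_rfl (by omega)] at hp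
  have hq := perBinom_eq (W := m + 2) (n := 3 * m + 2) (l := m) (by push_cast; omega) (by omega)
    (by omega)
  rw [binom_of_gt _ (show ((3 * m + 2 : ℕ) : ℤ) < m + 2 * (m + 2) by push_cast; omega),
    ← binom_symm _ (m + ((m : ℤ) + 2)),
    show ((3 * m + 2 : ℕ) : ℤ) - (m + (m + 2)) = m by push_cast; ring] at hq
  rw [binom_zero_right, ← binom_symm _ (0 + 2 * ((m : ℤ) + 2)), zero_add, zero_add,
    show ((3 * m + 2 : ℕ) : ℤ) - (2 * (m + 2)) = m - 2 by push_cast; ring] at hp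
  have hs := stripPaths_eq (w := m) (by omega) (3 * m + 2 + 2) (m + 2) (by push_cast; omega)
    (by push_cast; omega)
  have hz := stripPaths_eq (w := m) (by omega) (3 * m + 2 + 1) (m + 1) (by push_cast; omega)
    (by push_cast; omega)
  rw [stripPaths, if_neg (by push_cast; omega)] at hz
  have hc := pathCount_eq_stripPaths (3 * m + 2) (m + 2)
  rw [show ((3 * m + 2 : ℕ) : ℤ) + 2 - 2 * (m + 2 : ℕ) = m by push_cast; ring] at hc
  rw [show ((3 * m + 2 + 2 : ℕ) : ℤ) - 2 * (m + 2) = m by push_cast; ring, ← hc] at hs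
  clear hc
  generalize pathCount (3 * m + 2) (m + 2) = c at *
  generalize 3 * m + 2 = n at *
  simp only [perBinom] at hs hz
  rw [show (m : ℤ) + 2 - 1 = m + 1 by ring, show (m : ℤ) + 1 - 1 = m by ring] at hs
  rw [show (m : ℤ) + 1 - 1 = m by ring] at hz
  push_cast at hs hz hp hq
  zify
  linarith

end Cube

namespace Cube

variable {F : Type*} [Field F] {n : ℕ}

/-! ### The pairing of polynomials with functions on the cube -/

/-- The exponent of the squarefree monomial of the vertex `s`. -/
noncomputable def expo (s : Fin n → Bool) : Fin n →₀ ℕ :=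
  Finsupp.equivFunOnFinite.symm fun i => if s i then 1 else 0

lemma expo_apply (s : Fin n → Bool) (i : Fin n) : expo s i = if s i then 1 else 0 := rfl

lemma expo_injective : Function.Injective (expo : (Fin n → Bool) → (Fin n →₀ ℕ)) := by
  intro s t h
  ext i
  have := DFunLike.congr_fun h i
  rw [expo_apply, expo_apply] at this
  cases hs : s i <;> cases ht : t i <;> simp_all

lemma degree_expo (s : Fin n → Bool) : ((expo s).degree : ℤ) = weight s := by
  rw [Finsupp.degree_eq_sum, weight]
  push_cast
  exact Finset.sum_congr rfl fun i _ => by simp [expo_apply]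

lemma exists_expo_eq {m : Fin n →₀ ℕ} (hm : ∀ i, m i ≤ 1) : ∃ s, expo s = m := by
  refine ⟨fun i => decide (m i = 1), Finsupp.ext fun i => ?_⟩
  have := hm i
  rw [expo_apply]
  simp only [decide_eq_true_eq]
  split_ifs <;> omega

/-- The pairing of a polynomial with a function on the cube: only the squarefree monomials of the
polynomial contribute. -/
noncomputable def pairing (F : Type*) [Field F] (n : ℕ) :
    MvPolynomial (Fin n) F →ₗ[F] Cube F n →ₗ[F] F :=
  LinearMap.mk₂ F (fun p f => ∑ s, f s * coeff (expo s) p)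
    (fun p q f => by simp [mul_add, Finset.sum_add_distrib])
    (fun c p f => by simp [Finset.mul_sum, mul_left_comm])
    (fun p f g => by simp [add_mul, Finset.sum_add_distrib])
    (fun c p f => by simp [Finset.mul_sum, mul_assoc])

lemma pairing_apply (p : MvPolynomial (Fin n) F) (f : Cube F n) :
    pairing F n p f = ∑ s, f s * coeff (expo s) p := rfl

lemma pairing_monomial_expo (s : Fin n → Bool) (f : Cube F n) :
    pairing F n (monomial (expo s) 1) f = f s := by
  rw [pairing_apply, Finset.sum_eq_single s]
  · simp
  · intro t _ ht
    rw [coeff_monomial, if_neg fun h => ht (expo_injective h).symm, mul_zero]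
  · simp

lemma coeff_expo_X_mul (s : Fin n → Bool) (i : Fin n) (q : MvPolynomial (Fin n) F) :
    coeff (expo s) (X i * q) = if s i then coeff (expo (Function.update s i false)) q else 0 := by
  rw [coeff_X_mul']
  cases hs : s i
  · rw [if_neg (by simp [expo_apply, hs])]
    simp
  · rw [if_pos (by simp [expo_apply, hs]), if_pos rfl]
    congr 1
    ext j
    rw [Finsupp.tsub_apply, expo_apply, expo_apply]
    rcases eq_or_ne j i with rfl | hj
    · simp [hs]
    · simp [Function.update_of_ne hj, hj.symm]

lemma pairing_X_mul (i : Fin n) (q : MvPolynomial (Fin n) F) (f : Cube F n) :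
    pairing F n (X i * q) f =
      ∑ s, if s i then 0 else f (Function.update s i true) * coeff (expo s) q := by
  simp only [pairing_apply, coeff_expo_X_mul, mul_ite, mul_zero]
  rw [← Finset.sum_filter]
  simp only [← ite_not (p := _ = true)]
  rw [← Finset.sum_filter]
  refine Finset.sum_nbij' (fun s => Function.update s i false) (fun s => Function.update s i true)
    ?_ ?_ ?_ ?_ ?_
  · simp
  · simp
  · intro s hs
    have : s i = true := by simpa using hs
    simp [← this]
  · intro s hs
    have : s i = false := by simpa using hs
    simp [← this]
  · intro s hs
    have : s i = true := by simpa using hs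
    simp [← this]

lemma pairing_X_sq_mul (i : Fin n) (q : MvPolynomial (Fin n) F) (f : Cube F n) :
    pairing F n (X i ^ 2 * q) f = 0 := by
  rw [pow_two, mul_assoc, pairing_X_mul]
  refine Finset.sum_eq_zero fun s _ => ?_
  rw [coeff_expo_X_mul]
  split_ifs <;> simp

lemma lower_apply (a : ℕ → F) (f : Cube F n) (s : Fin n → Bool) :
    lower a n f s = ∑ i : Fin n, if s i then 0 else a i * f (Function.update s i true) := by
  induction n with
  | zero => simp
  | succ n ih =>
    rw [← Fin.snoc_init_self (α := fun _ => Bool) s]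
    generalize Fin.init s = t
    cases s (Fin.last n)
    · rw [← lo_apply (lower a (n + 1) f), lo_lower, Fin.sum_univ_castSucc]
      simp [ih, lo_apply, hi_apply, Fin.update_snoc_last (α := fun _ => Bool)]
    · rw [← hi_apply (lower a (n + 1) f), hi_lower, Fin.sum_univ_castSucc]
      simp [ih, hi_apply]

/-- A coefficient vector, extended by zeros to a sequence. -/
def extend (a : Fin n → F) (i : ℕ) : F := if h : i < n then a ⟨i, h⟩ else 0

@[simp] lemma extend_val (a : Fin n → F) (i : Fin n) : extend a i = a i := by simp [extend]

/-- Multiplication by a linear form is adjoint to the corresponding derivation. -/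
lemma pairing_linForm_mul (a : Fin n → F) (q : MvPolynomial (Fin n) F) (f : Cube F n) :
    pairing F n (linForm a * q) f = pairing F n q (lower (extend a) n f) := by
  have hsmul : ∀ i, C (a i) * X i * q = a i • (X i * q) := fun i => by rw [smul_eq_C_mul, mul_assoc]
  rw [linForm, Finset.sum_mul, map_sum, LinearMap.sum_apply]
  simp only [hsmul, map_smul, LinearMap.smul_apply, pairing_X_mul]
  simp only [pairing_apply, lower_apply, Finset.sum_mul, extend_val, Finset.smul_sum]
  rw [Finset.sum_comm]
  refine Finset.sum_congr rfl fun s _ => Finset.sum_congr rfl fun i _ => ?_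
  split_ifs <;> simp [mul_assoc]

lemma pairing_linForm_sq_mul (a : Fin n → F) (q : MvPolynomial (Fin n) F) (f : Cube F n) :
    pairing F n (linForm a ^ 2 * q) f = pairing F n q ((lower (extend a) n ^ 2) f) := by
  rw [pow_two, mul_assoc, pairing_linForm_mul, pairing_linForm_mul, pow_two, Module.End.mul_apply]

lemma isHomogeneous_linForm (a : Fin n → F) : (linForm a).IsHomogeneous 1 := by
  refine IsHomogeneous.sum _ _ _ fun i _ => ?_
  simpa using (isHomogeneous_C (Fin n) (a i)).mul (isHomogeneous_X F i)

/-- A functional on the quotient by an ideal that contains the squares of the variables is, in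
degree `d`, the pairing with a function on the cube. -/
lemma pairing_eq_of_X_sq_mem {J : Ideal (MvPolynomial (Fin n) F)} (hJ : ∀ i, X i ^ 2 ∈ J) {d : ℕ}
    (μ : (MvPolynomial (Fin n) F ⧸ J) →ₗ[F] F) {q : MvPolynomial (Fin n) F}
    (hq : q.IsHomogeneous d) :
    pairing F n q (fun s => if weight s = d then
      μ (Ideal.Quotient.mkₐ F J (monomial (expo s) 1)) else 0) = μ (Ideal.Quotient.mkₐ F J q) := by
  rw [q.as_sum]
  simp only [map_sum, LinearMap.sum_apply]
  refine Finset.sum_congr rfl fun m hm => ?_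
  have hmd : m.degree = d := by
    by_contra h
    exact mem_support_iff.1 hm (hq.coeff_eq_zero h)
  rw [show monomial m (coeff m q) = coeff m q • monomial m (1 : F) by simp [smul_monomial]]
  simp only [map_smul, LinearMap.smul_apply]
  congr 1
  by_cases hsq : ∀ i, m i ≤ 1
  · obtain ⟨s, rfl⟩ := exists_expo_eq hsq
    rw [pairing_monomial_expo, if_pos (by rw [← degree_expo, hmd])]
  · push Not at hsq
    obtain ⟨i, hi⟩ := hsq
    have hm2 : monomial m (1 : F) = X i ^ 2 * monomial (m - Finsupp.single i 2) 1 := by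
      rw [X_pow_eq_monomial, monomial_mul, one_mul, add_tsub_cancel_of_le]
      rwa [Finsupp.single_le_iff]
    rw [hm2, pairing_X_sq_mul]
    have : Ideal.Quotient.mkₐ F J (X i ^ 2 * monomial (m - Finsupp.single i 2) 1) = 0 :=
      Ideal.Quotient.eq_zero_iff_mem.2 (J.mul_mem_right _ (hJ i))
    rw [this, map_zero]

/-- Macaulay duality: the degree `d` piece of `F[x_1, …, x_n] / (x_i ^ 2, ℓ_1 ^ 2, ℓ_2 ^ 2)` is dual
to the space of forms of degree `d` on the cube killed by the squares of both derivations. -/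
theorem rank_quotientPiece (a b : Fin n → F) (d : ℕ) :
    Module.rank F (quotientPiece (squaresIdeal (linForm a) (linForm b)) d) =
      Module.finrank F ↥(killed (extend a) n d 2 ⊓ killed (extend b) n d 2) := by
  set J := squaresIdeal (linForm a) (linForm b) with hJ
  set W := killed (extend a) n d 2 ⊓ killed (extend b) n d 2 with hW
  have hXJ : ∀ i, X i ^ 2 ∈ J := fun i => Ideal.subset_span (Or.inl ⟨i, rfl⟩)
  have haJ : linForm a ^ 2 ∈ J := Ideal.subset_span (Or.inr (Or.inl rfl))
  have hbJ : linForm b ^ 2 ∈ J := Ideal.subset_span (Or.inr (Or.inr rfl))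
  have hpair : ∀ p ∈ J, ∀ f ∈ W, pairing F n p f = 0 := by
    intro p hp f hf
    refine Submodule.span_induction
      (p := fun p _ => ∀ q, pairing F n (p * q) f = 0) ?_ ?_ ?_ ?_ hp 1
      |> fun h => by simpa using h
    · rintro p (⟨i, rfl⟩ | rfl | rfl) q
      · exact pairing_X_sq_mul i q f
      · rw [pairing_linForm_sq_mul, (mem_killed.1 hf.1).2, map_zero]
      · rw [pairing_linForm_sq_mul, (mem_killed.1 hf.2).2, map_zero]
    · simp
    · intro p r _ _ hp hr q
      rw [add_mul, map_add, LinearMap.add_apply, hp, hr, add_zero]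
    · intro r p _ hp q
      rw [smul_eq_mul, mul_comm r p, mul_assoc, hp]
  let S : homogeneousSubmodule (Fin n) F d →ₗ[F] MvPolynomial (Fin n) F ⧸ J :=
    (Ideal.Quotient.mkₐ F J).toLinearMap.domRestrict _
  let B : homogeneousSubmodule (Fin n) F d →ₗ[F] W →ₗ[F] F :=
    (pairing F n).domRestrict₁₂ (homogeneousSubmodule (Fin n) F d) W
  have hSrange : LinearMap.range S = quotientPiece J d := by
    rw [quotientPiece, LinearMap.range_domRestrict]
  have hforms : ∀ (c : Fin n → F) (f : Cube F n), f ∈ forms F n d →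
      (∀ s, weight s = d - 2 → pairing F n (linForm c ^ 2 * monomial (expo s) 1) f = 0) →
        (lower (extend c) n ^ 2) f = 0 := by
    intro c f hf h
    ext s
    by_cases hs : weight s = d - 2
    · rw [← pairing_monomial_expo s ((lower (extend c) n ^ 2) f), ← pairing_linForm_sq_mul,
        h s hs, Pi.zero_apply]
    · exact lower_pow_mem hf 2 s (by simpa using hs)
  have hker : LinearMap.ker S = LinearMap.ker B := by
    ext ⟨p, hp⟩
    constructor
    · intro h
      have h' : p ∈ J := Ideal.Quotient.eq_zero_iff_mem.1 h
      exact LinearMap.ext fun f => hpair p h' f f.2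
    · intro h
      refine (Module.forall_dual_apply_eq_zero_iff F _).1 fun μ => ?_
      let f : Cube F n := fun s => if weight s = d then
        μ (Ideal.Quotient.mkₐ F J (monomial (expo s) 1)) else 0
      have hf : f ∈ forms F n d := fun s hs => if_neg hs
      have hkill : ∀ c : Fin n → F, linForm c ^ 2 ∈ J → (lower (extend c) n ^ 2) f = 0 := by
        intro c hc
        refine hforms c f hf fun s hs => ?_
        have hdeg : (linForm c ^ 2 * monomial (expo s) 1).IsHomogeneous d := by
          have h2 := ((isHomogeneous_linForm c).pow 2).mul
            (isHomogeneous_monomial (1 : F) (rfl : (expo s).degree = _))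
          have hd := degree_expo s
          rwa [show 1 * 2 + (expo s).degree = d by omega] at h2
        rw [pairing_eq_of_X_sq_mem hXJ μ hdeg]
        have : Ideal.Quotient.mkₐ F J (linForm c ^ 2 * monomial (expo s) 1) = 0 :=
          Ideal.Quotient.eq_zero_iff_mem.2 (J.mul_mem_right _ hc)
        rw [this, map_zero]
      have hfW : f ∈ W := ⟨⟨hf, hkill a haJ⟩, hf, hkill b hbJ⟩
      exact (pairing_eq_of_X_sq_mem hXJ μ hp).symm.trans (LinearMap.congr_fun h ⟨f, hfW⟩)
  have hsurj : Function.Surjective B := by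
    rw [← LinearMap.flip_injective_iff₂, injective_iff_map_eq_zero]
    rintro ⟨f, hf⟩ h
    refine Subtype.ext (funext fun s => ?_)
    by_cases hs : weight s = d
    · have hdeg : monomial (expo s) (1 : F) ∈ homogeneousSubmodule (Fin n) F d :=
        isHomogeneous_monomial 1 (by have := degree_expo s; omega)
      change f s = 0
      rw [← pairing_monomial_expo s f]
      exact LinearMap.congr_fun h ⟨_, hdeg⟩
    · exact hf.1.1 s hs
  have e : quotientPiece J d ≃ₗ[F] (W →ₗ[F] F) :=
    (LinearEquiv.ofEq _ _ hSrange).symm.trans (S.quotKerEquivRange.symm.trans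
      ((Submodule.quotEquivOfEq _ _ hker).trans (B.quotKerEquivOfSurjective hsurj)))
  rw [e.rank_eq, ← Module.finrank_eq_rank]
  exact congrArg _ Subspace.dual_finrank_eq

end Cube

/-! ### General pairs of linear forms -/

section

variable {F : Type*} [Field F]

/-- A property of sequences that holds generically and depends on the first `n` terms only, through
`R`, holds for general pairs of vectors. -/
lemma Generic.exists_polynomial [Infinite F] {n : ℕ}
    {Q : (ℕ → F) → (ℕ → F) → Prop} (hQ : Generic Q) {R : (Fin n → F) → (Fin n → F) → Prop}
    (hR : ∀ a b, Q a b → R (fun i => a i) fun i => b i) :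
    ∃ G : MvPolynomial (Fin n ⊕ Fin n) F, G ≠ 0 ∧
      ∀ a b, eval (Sum.elim a b) G ≠ 0 → R a b := by
  obtain ⟨G, hG, hQ⟩ := hQ
  obtain ⟨z, hz⟩ : ∃ z, eval z G ≠ 0 := by
    by_contra! h
    exact hG (MvPolynomial.funext fun z => by rw [h, map_zero])
  -- The terms from the `n`-th on are frozen at a point where `G` does not vanish.
  let σ : ℕ ⊕ ℕ → MvPolynomial (Fin n ⊕ Fin n) F := Sum.elim
    (fun i => if h : i < n then X (Sum.inl ⟨i, h⟩) else C (z (Sum.inl i)))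
    (fun i => if h : i < n then X (Sum.inr ⟨i, h⟩) else C (z (Sum.inr i)))
  let ex : (Fin n → F) → (ℕ → F) → ℕ → F := fun a y i => if h : i < n then a ⟨i, h⟩ else y i
  have hσ : ∀ a b : Fin n → F, eval (Sum.elim a b) (aeval σ G) =
      eval (Sum.elim (ex a fun i => z (Sum.inl i)) (ex b fun i => z (Sum.inr i))) G := by
    intro a b
    rw [aeval_def, ← eval₂_id, MvPolynomial.algebraMap_eq]
    rw [← coe_eval₂Hom, ← coe_eval₂Hom, ← RingHom.comp_apply]
    congr 1
    refine MvPolynomial.ringHom_ext (fun r => by simp) ?_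
    rintro (i | i)
    · by_cases h : i < n <;> simp [σ, ex, h]
    · by_cases h : i < n <;> simp [σ, ex, h]
  refine ⟨aeval σ G, ?_, fun a b hab => ?_⟩
  · intro h0
    have h := hσ (fun i => z (Sum.inl i)) fun i => z (Sum.inr i)
    rw [h0, map_zero] at h
    refine hz ?_
    rw [h]
    congr 2
    funext i
    rcases i with i | i <;> simp [ex]
  · rw [hσ] at hab
    simpa [ex] using hR _ _ (hQ _ _ hab)

end

namespace Cube

/-- The upper and the lower bound agree for `n = 3d - 4`, here with `d = m + 2`. -/
theorem generic_finrank_eq_pathCount (F : Type*) [Field F] [CharZero F] (m : ℕ) :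
    Generic fun a b : ℕ → F => Module.finrank F
      ↥(killed a (3 * m + 2) (m + 2) 2 ⊓ killed b (3 * m + 2) (m + 2) 2) =
        pathCount (3 * m + 2) (m + 2) := by
  have hne : Generic fun a _ : ℕ → F => ∀ i < 3 * m + 2, a i ≠ 0 :=
    Generic.forall_lt _ fun i _ => Generic.of_isPoly (IsPolyFun.left i) 1 1 one_ne_zero
  have hne' : Generic fun _ b : ℕ → F => ∀ i < 3 * m + 2, b i ≠ 0 :=
    Generic.forall_lt _ fun i _ => Generic.of_isPoly (IsPolyFun.right i) 1 1 one_ne_zero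
  have hminor : Generic fun a b : ℕ → F =>
      ∀ i < 3 * m + 2, ∀ j < i, a i * b j - a j * b i ≠ 0 :=
    Generic.forall_lt _ fun i _ => Generic.forall_lt _ fun j hj => Generic.of_isPoly
      (((IsPolyFun.left i).mul (.right j)).sub ((IsPolyFun.left j).mul (.right i)))
      (Pi.single i 1) (Pi.single j 1) (by simp [hj.ne])
  have hup := generic_finrank_le_stripPaths (F := F) (3 * m + 2) (m + 2) 2
  refine (((hne.and hne').and hminor).and hup).mono fun a b h => ?_
  obtain ⟨⟨⟨ha, hb⟩, hab⟩, hle⟩ := h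
  have hlow := binom_le_finrank_inf_killed ha hb hab
  have hpath := pathCount_add m
  -- The last move of a lattice path goes from the line `x = m - 1` to the line `x = m`.
  have hstrip : stripPaths m (3 * m + 2 + 1) (m - 1) ≤ pathCount (3 * m + 2) (m + 2) := by
    rw [pathCount_eq_stripPaths,
      show ((3 * m + 2 : ℕ) : ℤ) + 2 - 2 * (m + 2 : ℕ) = m by push_cast; ring]
    conv_rhs => rw [stripPaths, if_pos (by omega)]
    exact Nat.le_add_right _ _
  rw [show ((3 * m + 2 : ℕ) : ℤ) - 2 * (m + 2) + (2 : ℕ) = m by push_cast; ring,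
    show ((3 * m + 2 : ℕ) : ℤ) - 2 * (m + 2) + 1 = m - 1 by push_cast; ring] at hle
  omega

lemma killed_extend {F : Type*} [Field F] (n : ℕ) (c : ℕ → F) (d : ℤ) (k : ℕ) :
    killed (extend fun i : Fin n => c i) n d k = killed c n d k := by
  rw [killed, killed, lower_congr (b := c) fun i hi => by simp [extend, hi]]

end Cube

theorem corollary5p5 (F : Type*) [Field F] [CharZero F] (n d : ℕ)
    (hnd : (n : ℤ) = 3 * (d : ℤ) - 4) :
    ForGeneralPair (fun l₁ l₂ : MvPolynomial (Fin n) F =>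
      Module.rank F (quotientPiece (squaresIdeal l₁ l₂) d) = (pathCount n d : Cardinal)) := by
  obtain ⟨m, rfl⟩ : ∃ m, d = m + 2 := ⟨d - 2, by omega⟩
  obtain rfl : n = 3 * m + 2 := by push_cast at hnd; omega
  refine (Cube.generic_finrank_eq_pathCount F m).exists_polynomial fun a b h => ?_
  beta_reduce
  rw [Cube.rank_quotientPiece, Cube.killed_extend, Cube.killed_extend, ← h]
  push_cast
  rfl
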